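/- Let $\mathcal H$ be a separable real Hilbert space, let $A,B$ be nonnegative definite trace class operators on $\mathcal H$, and let $\varepsilon>0$. Square roots of nonnegative definite operators are nonnegative definite, $\dagger$ is the Moore–Penrose inverse, and $\mathcal N,\mathcal R$ denote null space and range. Assume that $B$ is reachable from $A$ ($A\rightsquigarrow B$): there is a possibly unbounded linear operator $T:\mathcal R(A^{1/2})\to\mathcal H$ with $(TA^{1/2})(TA^{1/2})^*=B$ and $\mathrm{tr}(TA)=\mathrm{tr}[(A^{1/2}BA^{1/2})^{1/2}]$. Write $\mathcal H=\mathcal H_1\oplus\mathcal H_2$ with $\mathcal H_1=\overline{\mathcal R(A)}$ and $\mathcal H_2=\mathcal N(A)$, denote by $A_{ij},B_{ij}$ the corresponding blocks of $A,B$, and put $P_{11}=A_{11}^{1/2}B_{11}A_{11}^{1/2}$ and $B/A=\big[B^{1/2}\Pi_{\mathcal N(A^{1/2}B^{1/2})}B^{1/2}\big]\big|_{\mathcal H_2}$, where $\Pi_{\mathcal V}$ is the orthogonal projection onto $\mathcal V$. Let $$G_0=A^{1/2},\qquad M_0=\begin{pmatrix}A_{11}^{\dagger/2}P_{11}^{1/2}&0\\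 \big[P_{11}^{\dagger/2}A_{11}^{1/2}B_{12}\big]^*&(B/A)^{1/2}\end{pmatrix}.$$ Then the functional $$R\longmapsto 2\,\mathrm{tr}[R(M_0^*G_0)]+\varepsilon\log\det(I-R^*R)$$ ($\det$ the Fredholm determinant) has a unique maximizer $R_\varepsilon$ over the Hilbert–Schmidt operators $R$ on $\mathcal H$ with $\mathcal N(R)\supseteq\mathcal N(M_0)$, $\mathcal R(R)\subseteq\mathcal N(G_0)^\perp$ and operator norm $\|R\|<1$, and $R_\varepsilon=f_\varepsilon(G_0^*M_0)$ with $f_\varepsilon(x)=2x/(\sqrt{4x^2+\varepsilon^2}+\varepsilon)$. Let $\pi_\varepsilon=N(0,\Sigma_\varepsilon)$ (the Gaussian entropic optimal transport coupling of $N(0,A)$ and $N(0,B)$) and $\pi_0=N(0,\Sigma_0)$ (the canonical optimal transport coupling) be the centered Gaussian measures on $\mathcal H\times\mathcal H$ with covariance operators $$\Sigma_\varepsilon=\begin{pmatrix}A&G_0R_\varepsilon M_0^*\\ (G_0R_\varepsilon M_0^*)^*&B\end{pmatrix},\qquad \Sigma_0=\begin{pmatrix}A&G_0M_0^*\\ M_0G_0^*&B\end{pmatrix}.$$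 Both measures exist. The operator $$Q_\varepsilon=(G_0^*G_0)^2+(M_0^*M_0)^2+(G_0^*G_0)R_\varepsilon(M_0^*M_0)+(M_0^*M_0)R_\varepsilon(G_0^*G_0)$$ on $\mathcal H$ is nonnegative definite, $\sqrt{Q_\varepsilon}$ is trace class, and the 2-Wasserstein distance (the square root of the infimum of $\int\|z-w\|^2\,d\gamma(z,w)$ over all couplings $\gamma$ of the two measures) is finite and satisfies $$\mathcal W_2^2(\pi_\varepsilon,\pi_0)=2\,\mathrm{tr}\big[A+B-\sqrt{Q_\varepsilon}\big].$$ -/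

import Mathlib

open MeasureTheory ProbabilityTheory
open scoped ENNReal InnerProductSpace

namespace GaussianEOT

noncomputable section

/-! ### Square roots, traces and Schatten classes on a real Hilbert space -/

section Operators

variable {H : Type*} [NormedAddCommGroup H] [InnerProductSpace ℝ H] [CompleteSpace H]

/-- A nonnegative definite bounded operator of norm at most one has a nonnegative definite square
root (limit of the iteration `S ↦ ((1 - T) + S ^ 2) / 2`, subtracted from the identity). -/
theorem exists_sqrt_of_norm_le_one (T : H →L[ℝ] H) (hT : T.IsPositive) (hT1 : ‖1 - T‖ ≤ 1) :
    ∃ S : H →L[ℝ] H, S.IsPositive ∧ S * S = T := by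
  let X : H →L[ℝ] H := 1 - T
  obtain ⟨S, hS0, hS⟩ : ∃ S : ℕ → (H →L[ℝ] H), S 0 = 0 ∧
      ∀ n, S (n + 1) = (2⁻¹ : ℝ) • (X + S n * S n) :=
    ⟨fun n => Nat.rec 0 (fun _ s => (2⁻¹ : ℝ) • (X + s * s)) n, rfl, fun _ => rfl⟩
  obtain ⟨a, ha0, ha⟩ : ∃ a : ℕ → ℝ, a 0 = 0 ∧ ∀ n, a (n + 1) = 2⁻¹ * (1 + a n * a n) :=
    ⟨fun n => Nat.rec 0 (fun _ s => 2⁻¹ * (1 + s * s)) n, rfl, fun _ => rfl⟩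
  have hapos : ∀ n, 0 ≤ a n ∧ a n ≤ 1 := by
    intro n
    induction n with
    | zero => simp [ha0]
    | succ n ih => rw [ha]; constructor <;> nlinarith [ih.1, ih.2]
  have hSn : ∀ n, ‖S n‖ ≤ a n := by
    intro n
    induction n with
    | zero => simp [hS0, ha0]
    | succ n ih =>
      rw [hS, ha, norm_smul]
      have h1 : ‖X + S n * S n‖ ≤ 1 + a n * a n :=
        (norm_add_le _ _).trans (add_le_add hT1 ((norm_mul_le _ _).trans
          (mul_le_mul ih ih (norm_nonneg _) (hapos n).1)))
      have h2 : ‖(2⁻¹ : ℝ)‖ = 2⁻¹ := by norm_num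
      rw [h2]
      linarith
  have hdiff : ∀ n, ‖S (n + 1) - S n‖ ≤ a (n + 1) - a n := by
    intro n
    induction n with
    | zero =>
      rw [hS0, ha0, sub_zero, sub_zero]
      exact hSn 1
    | succ n ih =>
      have e : S (n + 1 + 1) - S (n + 1)
          = (2⁻¹ : ℝ) • (S (n + 1) * (S (n + 1) - S n) + (S (n + 1) - S n) * S n) := by
        have e1 : S (n + 1 + 1) - S (n + 1)
            = (2⁻¹ : ℝ) • ((X + S (n + 1) * S (n + 1)) - (X + S n * S n)) := by
          rw [smul_sub, ← hS (n + 1), ← hS n]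
        rw [e1]
        congr 1
        rw [mul_sub, sub_mul]
        abel
      have h1 : ‖S (n + 1) * (S (n + 1) - S n) + (S (n + 1) - S n) * S n‖
          ≤ a (n + 1) * (a (n + 1) - a n) + (a (n + 1) - a n) * a n := by
        refine (norm_add_le _ _).trans (add_le_add ((norm_mul_le _ _).trans ?_)
          ((norm_mul_le _ _).trans ?_))
        · exact mul_le_mul (hSn _) ih (norm_nonneg _) (hapos _).1
        · exact mul_le_mul ih (hSn _) (norm_nonneg _) ((norm_nonneg _).trans ih)
      have h2 : ‖(2⁻¹ : ℝ)‖ = 2⁻¹ := by norm_num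
      rw [e, norm_smul, h2]
      have h3 := ha (n + 1)
      have h4 := ha n
      nlinarith
  have hmono : Monotone a := monotone_nat_of_le_succ fun n => by
    have := (norm_nonneg _).trans (hdiff n)
    linarith
  have hsum : Summable fun n => a (n + 1) - a n := by
    refine summable_of_sum_range_le (c := 1) (fun n => sub_nonneg.2 (hmono (Nat.le_succ n))) ?_
    intro n
    rw [Finset.sum_range_sub, ha0, sub_zero]
    exact (hapos n).2
  have hc : CauchySeq S := by
    refine cauchySeq_of_dist_le_of_summable _ (fun n => ?_) hsum
    rw [dist_comm, dist_eq_norm]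
    exact hdiff n
  obtain ⟨L, hL⟩ := cauchySeq_tendsto_of_complete hc
  have hLeq : L = (2⁻¹ : ℝ) • (X + L * L) := by
    refine tendsto_nhds_unique ((Filter.tendsto_add_atTop_iff_nat 1).2 hL) ?_
    simp only [hS]
    exact (tendsto_const_nhds.add (hL.mul hL)).const_smul _
  have hLn : ‖L‖ ≤ 1 := le_of_tendsto hL.norm
    (Filter.Eventually.of_forall fun n => (hSn n).trans (hapos n).2)
  have hXsa : IsSelfAdjoint X := (IsSelfAdjoint.one (H →L[ℝ] H)).sub hT.isSelfAdjoint
  have hSsa : ∀ n, IsSelfAdjoint (S n) := by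
    intro n
    induction n with
    | zero =>
      rw [hS0]
      exact IsSelfAdjoint.zero (H →L[ℝ] H)
    | succ n ih =>
      rw [hS]
      refine IsSelfAdjoint.smul (IsSelfAdjoint.all (2⁻¹ : ℝ)) (hXsa.add ?_)
      have := IsSelfAdjoint.mul_star_self (S n)
      rwa [ih.star_eq] at this
  have hLsa : IsSelfAdjoint L := by
    have h1 : Filter.Tendsto (fun n => star (S n)) Filter.atTop (nhds (star L)) :=
      (continuous_star.tendsto L).comp hL
    have h2 : (fun n => star (S n)) = S := funext fun n => (hSsa n).star_eq
    rw [h2] at h1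
    exact tendsto_nhds_unique h1 hL
  refine ⟨1 - L, ?_, ?_⟩
  · rw [ContinuousLinearMap.isPositive_iff']
    refine ⟨(IsSelfAdjoint.one _).sub hLsa, fun x => ?_⟩
    have h1 : ⟪L x, x⟫_ℝ ≤ ‖x‖ * ‖x‖ := (real_inner_le_norm _ _).trans
      (mul_le_mul_of_nonneg_right ((L.le_opNorm x).trans
        (mul_le_of_le_one_left (norm_nonneg _) hLn)) (norm_nonneg _))
    have h2 : ⟪(1 - L : H →L[ℝ] H) x, x⟫_ℝ = ‖x‖ * ‖x‖ - ⟪L x, x⟫_ℝ := by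
      rw [_root_.sub_apply, inner_sub_left]
      rw [one_apply_eq_self, real_inner_self_eq_norm_mul_norm]
    rw [h2]
    linarith
  · have h2 : (2 : ℝ) • L = X + L * L := by
      nth_rewrite 1 [hLeq]
      rw [smul_smul]
      norm_num
    have h3 : L + L = X + L * L := by rw [← h2, two_smul]
    have h4 : (1 - L) * (1 - L) = 1 - (L + L) + L * L := by noncomm_ring
    rw [h4, h3]
    simp only [X]
    abel

/-- Every nonnegative definite bounded operator has a nonnegative definite square root. -/
theorem exists_sqrt (T : H →L[ℝ] H) (hT : T.IsPositive) :
    ∃ S : H →L[ℝ] H, S.IsPositive ∧ S ∘L S = T := by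
  by_cases h0 : T = 0
  · exact ⟨0, ContinuousLinearMap.isPositive_zero, by simp [h0]⟩
  have hn : 0 < ‖T‖ := norm_pos_iff.2 h0
  set c : ℝ := ‖T‖⁻¹ with hc
  have hcpos : 0 < c := inv_pos.2 hn
  have hpos : (c • T).IsPositive := by
    rw [ContinuousLinearMap.isPositive_iff']
    refine ⟨IsSelfAdjoint.smul (IsSelfAdjoint.all _) hT.isSelfAdjoint, fun x => ?_⟩
    rw [_root_.smul_apply, real_inner_smul_left]
    exact mul_nonneg hcpos.le (hT.inner_nonneg_left x)
  have hnorm : ‖c • T‖ ≤ 1 := by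
    rw [norm_smul, Real.norm_of_nonneg hcpos.le, hc, inv_mul_cancel₀ hn.ne']
  have hle : ‖1 - c • T‖ ≤ 1 := by
    have hsa : IsSelfAdjoint (1 - c • T) := (IsSelfAdjoint.one _).sub hpos.isSelfAdjoint
    have hp1 : (1 - c • T).IsPositive := by
      rw [ContinuousLinearMap.isPositive_iff']
      refine ⟨hsa, fun x => ?_⟩
      have h1 : ⟪(c • T) x, x⟫_ℝ ≤ ‖x‖ * ‖x‖ := (real_inner_le_norm _ _).trans
        (mul_le_mul_of_nonneg_right (((c • T).le_opNorm x).trans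
          (mul_le_of_le_one_left (norm_nonneg _) hnorm)) (norm_nonneg _))
      rw [_root_.sub_apply, inner_sub_left]
      simp only [one_apply_eq_self, real_inner_self_eq_norm_mul_norm]
      linarith
    have key : ∀ x, ⟪(1 - c • T) x, x⟫_ℝ ≤ ‖x‖ * ‖x‖ := fun x => by
      rw [_root_.sub_apply, inner_sub_left]
      simp only [one_apply_eq_self, real_inner_self_eq_norm_mul_norm]
      linarith [hpos.inner_nonneg_left x]
    -- Cauchy-Schwarz for the positive form of `1 - c • T`
    set Y := 1 - c • T with hY
    refine ContinuousLinearMap.opNorm_le_bound _ zero_le_one fun x => ?_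
    have hq : ∀ t : ℝ, 0 ≤ ⟪Y (t • x + Y x), t • x + Y x⟫_ℝ := fun t => hp1.inner_nonneg_left _
    have hsym : ∀ u v, ⟪Y u, v⟫_ℝ = ⟪u, Y v⟫_ℝ := fun u v => by
      have := ContinuousLinearMap.adjoint_inner_right Y u v
      rw [hsa.adjoint_eq] at this
      exact this.symm
    have hexp : ∀ t : ℝ, ⟪Y (t • x + Y x), t • x + Y x⟫_ℝ
        = ⟪Y x, x⟫_ℝ * (t * t) + (2 * ⟪Y x, Y x⟫_ℝ) * t + ⟪Y (Y x), Y x⟫_ℝ := by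
      intro t
      simp only [map_add, map_smul, inner_add_left, inner_add_right, real_inner_smul_left,
        real_inner_smul_right]
      rw [hsym (Y x) x]
      ring
    have hd := discrim_le_zero fun t => (hq t).trans_eq (hexp t)
    simp only [discrim] at hd
    have k1 := key x
    have k2 := key (Y x)
    have k3 := hp1.inner_nonneg_left x
    have k4 := hp1.inner_nonneg_left (Y x)
    rw [real_inner_self_eq_norm_mul_norm] at hd
    rw [one_mul]
    by_contra hlt
    push Not at hlt
    have hx := norm_nonneg x
    have hy : 0 < ‖Y x‖ := hx.trans_lt hlt
    have h5 : (‖Y x‖ * ‖Y x‖) * (‖Y x‖ * ‖Y x‖) ≤ (‖x‖ * ‖x‖) * (‖Y x‖ * ‖Y x‖) := by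
      have := mul_le_mul k1 k2 k4 (mul_nonneg hx hx)
      nlinarith
    have h6 := le_of_mul_le_mul_right h5 (mul_pos hy hy)
    nlinarith
  obtain ⟨S, hS, hSS⟩ := exists_sqrt_of_norm_le_one (c • T) hpos hle
  refine ⟨Real.sqrt ‖T‖ • S, ?_, ?_⟩
  · rw [ContinuousLinearMap.isPositive_iff']
    refine ⟨IsSelfAdjoint.smul (IsSelfAdjoint.all _) hS.isSelfAdjoint, fun x => ?_⟩
    rw [_root_.smul_apply, real_inner_smul_left]
    exact mul_nonneg (Real.sqrt_nonneg _) (hS.inner_nonneg_left x)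
  · rw [← ContinuousLinearMap.mul_def, smul_mul_smul_comm, hSS,
      Real.mul_self_sqrt hn.le, smul_smul, hc, mul_inv_cancel₀ hn.ne', one_smul]

open Classical in
/-- The (unique) nonnegative definite square root `T^{1/2}` of a nonnegative definite bounded
operator `T`. It is only used for such operators. -/
def opSqrt (T : H →L[ℝ] H) : H →L[ℝ] H :=
  if hT : T.IsPositive then (exists_sqrt T hT).choose else 0

theorem opSqrt_spec (T : H →L[ℝ] H) (hT : T.IsPositive) :
    (opSqrt T).IsPositive ∧ opSqrt T ∘L opSqrt T = T := by
  rw [opSqrt, dif_pos hT]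
  exact (exists_sqrt T hT).choose_spec

/-- `K` is trace class: `∑ ⟪e, |K| e⟫ < ∞` for every orthonormal basis, `|K| = (K* K)^{1/2}`.
(An orthonormal basis is indexed here by a subset of `H`.) -/
def IsTraceClass (K : H →L[ℝ] H) : Prop :=
  ∀ (s : Set H) (b : HilbertBasis s ℝ H),
    Summable fun i => ⟪b i, opSqrt (ContinuousLinearMap.adjoint K ∘L K) (b i)⟫_ℝ

/-- `K` is Hilbert-Schmidt: `∑ ‖K e‖ ^ 2 < ∞` for every orthonormal basis. -/
def IsHilbertSchmidt (K : H →L[ℝ] H) : Prop :=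
  ∀ (s : Set H) (b : HilbertBasis s ℝ H), Summable fun i => ‖K (b i)‖ ^ 2

/-- An orthonormal basis of `H`. -/
def someBasis (H : Type*) [NormedAddCommGroup H] [InnerProductSpace ℝ H] [CompleteSpace H] :
    HilbertBasis (exists_hilbertBasis ℝ H).choose ℝ H :=
  (exists_hilbertBasis ℝ H).choose_spec.choose

/-- The trace `∑ ⟪e, K e⟫` of a trace class operator, which does not depend on the basis. -/
def trace (K : H →L[ℝ] H) : ℝ := ∑' i, ⟪someBasis H i, K (someBasis H i)⟫_ℝ

/-- Covariance operators: nonnegative definite trace class operators. -/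
def IsCovariance (A : H →L[ℝ] H) : Prop := A.IsPositive ∧ IsTraceClass A

/-- The Fredholm determinant `det (I - T)` of a nonnegative definite trace class operator `T`: the
product of `1 - μ` over the eigenvalues `μ` of `T`, counted with multiplicity. -/
def fredholmDetOneSub (T : H →L[ℝ] H) : ℝ :=
  ∏' μ : ℝ, (1 - μ) ^ Module.finrank ℝ (Module.End.eigenspace (T : H →ₗ[ℝ] H) μ)

/-- The Moore-Penrose inverse applied to an operator: if `R(S) ⊆ R(T)`, there is exactly one
bounded operator `D` with `T D = S` and `R(D) ⊆ N(T)ᗮ`, namely `D = T† S`. -/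
theorem exists_pinvComp (T S : H →L[ℝ] H) (h : ∀ x, ∃ y, T y = S x) :
    ∃ D : H →L[ℝ] H, T ∘L D = S ∧ ∀ x, D x ∈ (LinearMap.ker (T : H →ₗ[ℝ] H))ᗮ := by
  set N := LinearMap.ker (T : H →ₗ[ℝ] H) with hN
  have hNc : IsClosed (N : Set H) := T.isClosed_ker
  have : CompleteSpace N := hNc.completeSpace_coe
  have hex : ∀ x, ∃ y, T y = S x ∧ y ∈ Nᗮ := by
    intro x
    obtain ⟨y, hy⟩ := h x
    refine ⟨y - N.starProjection y, ?_, Submodule.sub_starProjection_mem_orthogonal y⟩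
    have h0 : T (N.starProjection y) = 0 := by
      exact LinearMap.mem_ker.1 (Submodule.starProjection_apply_mem N y)
    rw [map_sub, h0, sub_zero, hy]
  have huniq : ∀ y z, T y = T z → y ∈ Nᗮ → z ∈ Nᗮ → y = z := by
    intro y z hyz hy hz
    have h1 : y - z ∈ N := by simp [hN, hyz]
    have h2 : y - z ∈ Nᗮ := Nᗮ.sub_mem hy hz
    have := (Submodule.disjoint_def.1 N.orthogonal_disjoint) _ h1 h2
    exact sub_eq_zero.1 this
  choose f hf hfN using hex
  let g : H →ₗ[ℝ] H :=
    { toFun := f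
      map_add' := fun x y => huniq _ _ (by simp [hf]) (hfN _) (Nᗮ.add_mem (hfN _) (hfN _))
      map_smul' := fun c x => huniq _ _ (by simp [hf]) (hfN _) (Nᗮ.smul_mem _ (hfN _)) }
  have hg : IsClosed (g.graph : Set (H × H)) := by
    have : (g.graph : Set (H × H)) = {p | T p.2 = S p.1} ∩ {p | p.2 ∈ Nᗮ} := by
      ext ⟨x, y⟩
      simp only [SetLike.mem_coe, LinearMap.mem_graph_iff, Set.mem_inter_iff, Set.mem_ofPred_eq]
      constructor
      · rintro rfl
        exact ⟨hf x, hfN x⟩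
      · rintro ⟨h1, h2⟩
        exact huniq _ _ (h1.trans (hf x).symm) h2 (hfN x)
    rw [this]
    refine (isClosed_eq (by fun_prop) (by fun_prop)).inter ?_
    exact N.isClosed_orthogonal.preimage continuous_snd
  refine ⟨ContinuousLinearMap.ofIsClosedGraph hg, ?_, ?_⟩
  · ext x
    exact hf x
  · intro x
    exact hfN x

open Classical in
/-- `pinvComp T S` is the operator `T† S`, with `T†` the (possibly unbounded) Moore-Penrose
inverse of `T`. It is only used when `R(S) ⊆ R(T)`. -/
def pinvComp (T S : H →L[ℝ] H) : H →L[ℝ] H :=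
  if h : ∀ x, ∃ y, T y = S x then (exists_pinvComp T S h).choose else 0

theorem pinvComp_spec (T S : H →L[ℝ] H) (h : ∀ x, ∃ y, T y = S x) :
    T ∘L pinvComp T S = S ∧ ∀ x, pinvComp T S x ∈ (LinearMap.ker (T : H →ₗ[ℝ] H))ᗮ := by
  rw [pinvComp, dif_pos h]
  exact (exists_pinvComp T S h).choose_spec

end Operators

/-! ### Reachability and the canonical Green's operators -/

section Green

variable {H : Type*} [NormedAddCommGroup H] [InnerProductSpace ℝ H] [CompleteSpace H]

/-- The operator `P = A^{1/2} B A^{1/2}`. -/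
def crossOp (A B : H →L[ℝ] H) : H →L[ℝ] H := opSqrt A ∘L B ∘L opSqrt A

/-- `B` is reachable from `A`: there is a (possibly unbounded) linear operator `T` defined on
`R(A^{1/2})` with `(T A^{1/2}) (T A^{1/2})* = B` and `tr (T A) = tr (A^{1/2} B A^{1/2})^{1/2}`.
Here `L = T A^{1/2}`, which is everywhere defined and has to be bounded (its adjoint is everywhere
defined), and `T A = L A^{1/2}`. -/
def Reachable (A B : H →L[ℝ] H) : Prop :=
  ∃ (T : LinearMap.range (opSqrt A : H →ₗ[ℝ] H) →ₗ[ℝ] H) (L : H →L[ℝ] H),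
    (∀ x, L x = T ((opSqrt A : H →ₗ[ℝ] H).rangeRestrict x)) ∧
    L ∘L ContinuousLinearMap.adjoint L = B ∧
    trace (L ∘L opSqrt A) = trace (opSqrt (crossOp A B))

/-- Orthogonal projection onto the null space of `T`. -/
def kerProj (T : H →L[ℝ] H) : H →L[ℝ] H := (LinearMap.ker (T : H →ₗ[ℝ] H)).starProjection

/-- The Schur operator `B^{1/2} Π_{N(A^{1/2} B^{1/2})} B^{1/2}` as an operator on `H`: it vanishes
on the closure of `R(A)` and leaves `N(A)` invariant. -/
def schurOp (A B : H →L[ℝ] H) : H →L[ℝ] H :=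
  opSqrt B ∘L kerProj (opSqrt A ∘L opSqrt B) ∘L opSqrt B

/-- The canonical Green's operator `G₀ = A^{1/2}` of `A`. -/
def greenG (A : H →L[ℝ] H) : H →L[ℝ] H := opSqrt A

/-- The canonical Green's operator `M₀` of `B`. With respect to `H = H₁ ⊕ H₂`, where `H₁` is the
closure of `R(A)` and `H₂ = N(A)`, the three summands are the diagonal block
`A₁₁^{†/2} P₁₁^{1/2}` on `H₁`, the block `[P₁₁^{†/2} A₁₁^{1/2} B₁₂]*` from `H₁` to `H₂`, and the
square root of the Schur operator on `H₂`. -/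
def greenM (A B : H →L[ℝ] H) : H →L[ℝ] H :=
  pinvComp (opSqrt A) (opSqrt (crossOp A B))
    + ContinuousLinearMap.adjoint
        (pinvComp (opSqrt (crossOp A B)) (opSqrt A ∘L B ∘L kerProj A))
    + opSqrt (schurOp A B)

end Green

/-! ### The entropic problem in terms of correlation operators -/

section Entropic

variable {H : Type*} [NormedAddCommGroup H] [InnerProductSpace ℝ H] [CompleteSpace H]

/-- The set `F(G, M)` of admissible correlation operators: Hilbert-Schmidt operators `R` with
`N(M) ⊆ N(R)`, `R(R) ⊆ N(G)ᗮ` and operator norm less than one. -/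
def admissible (G M : H →L[ℝ] H) : Set (H →L[ℝ] H) :=
  {R | IsHilbertSchmidt R ∧
    LinearMap.ker (M : H →ₗ[ℝ] H) ≤ LinearMap.ker (R : H →ₗ[ℝ] H) ∧
    LinearMap.range (R : H →ₗ[ℝ] H) ≤ (LinearMap.ker (G : H →ₗ[ℝ] H))ᗮ ∧
    ‖R‖ < 1}

/-- The entropic profit `2 tr (R (M* G)) + ε log det (I - R* R)`. -/
def entropicProfit (ε : ℝ) (G M R : H →L[ℝ] H) : ℝ :=
  2 * trace (R ∘L (ContinuousLinearMap.adjoint M ∘L G))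
    + ε * Real.log (fredholmDetOneSub (ContinuousLinearMap.adjoint R ∘L R))

/-- `R = argmax` of the entropic profit over `F(G, M)`, i.e. `R` is its unique maximizer. -/
def IsEntropicArgmax (ε : ℝ) (G M R : H →L[ℝ] H) : Prop :=
  R ∈ admissible G M ∧
    ∀ R' ∈ admissible G M, R' ≠ R → entropicProfit ε G M R' < entropicProfit ε G M R

/-- The spectral shrinkage function `f_ε`. -/
def shrinkage (ε x : ℝ) : ℝ := 2 * x / (Real.sqrt (4 * x ^ 2 + ε ^ 2) + ε)

/-- `F = f(K)` in the sense of the functional calculus of a compact self-adjoint operator `K`: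
`F` is multiplication by `f(x)` on the eigenspace of `K` for the eigenvalue `x`. As the eigenspaces
span a dense subspace, this determines the bounded operator `F`. -/
def IsFunctionOf (f : ℝ → ℝ) (K F : H →L[ℝ] H) : Prop :=
  ∀ (x : ℝ) (v : H), K v = x • v → F v = f x • v

/-- The operator on `H` whose square root enters the distance formula. -/
def distOp (G M R : H →L[ℝ] H) : H →L[ℝ] H :=
  (ContinuousLinearMap.adjoint G * G) ^ 2 + (ContinuousLinearMap.adjoint M * M) ^ 2
    + (ContinuousLinearMap.adjoint G * G) * R * (ContinuousLinearMap.adjoint M * M)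
    + (ContinuousLinearMap.adjoint M * M) * R * (ContinuousLinearMap.adjoint G * G)

/-- The block operator `(A C; D B)` on the Hilbert space `H × H` (with the `ℓ²` norm). -/
def blockOp (A C D B : H →L[ℝ] H) : WithLp 2 (H × H) →L[ℝ] WithLp 2 (H × H) :=
  (WithLp.prodContinuousLinearEquiv 2 ℝ H H).symm.toContinuousLinearMap ∘L
    ((A ∘L WithLp.fstL 2 ℝ H H + C ∘L WithLp.sndL 2 ℝ H H).prod
      (D ∘L WithLp.fstL 2 ℝ H H + B ∘L WithLp.sndL 2 ℝ H H))

/-- The covariance operator with marginal covariances `A`, `B` and cross-covariance `C`. -/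
def jointCov (A B C : H →L[ℝ] H) : WithLp 2 (H × H) →L[ℝ] WithLp 2 (H × H) :=
  blockOp A C (ContinuousLinearMap.adjoint C) B

end Entropic

/-! ### Gaussian measures and the Wasserstein distance -/

section Measures

/-- `π = N(0, S)`: `π` is Gaussian with mean zero and covariance operator `S`. -/
structure IsCenteredGaussian {E : Type*} [NormedAddCommGroup E] [InnerProductSpace ℝ E]
    [CompleteSpace E] [MeasurableSpace E] [BorelSpace E] (π : Measure E) (S : E →L[ℝ] E) :
    Prop where
  isGaussian : IsGaussian π
  mean_zero : ∫ x, x ∂π = 0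
  covariance : covarianceOperator π = S

/-- The 2-Wasserstein distance: infimum over all couplings of the quadratic transport cost. -/
def wasserstein2 {E : Type*} [NormedAddCommGroup E] [MeasurableSpace E] (μ ν : Measure E) : ℝ≥0∞ :=
  (⨅ γ ∈ {γ : Measure (E × E) | γ.map Prod.fst = μ ∧ γ.map Prod.snd = ν},
    ∫⁻ z, ‖z.1 - z.2‖ₑ ^ 2 ∂γ) ^ (1 / 2 : ℝ)

end Measures

end

end GaussianEOT

namespace GaussianEOT

noncomputable section

set_option linter.unusedSectionVars false

open ContinuousLinearMap (adjoint)

/-! ### Hilbert-Schmidt operators and their inner product -/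

section HilbertSchmidtOperators

variable {E F K : Type*} [NormedAddCommGroup E] [InnerProductSpace ℝ E] [CompleteSpace E]
  [NormedAddCommGroup F] [InnerProductSpace ℝ F] [CompleteSpace F]
  [NormedAddCommGroup K] [InnerProductSpace ℝ K] [CompleteSpace K]

/-! Everything rests on the factor `V x = (G₀ x, M₀ x)`, the operator `jointFactor`. Polar
decomposition `B^{1/2} A^{1/2} = U P^{1/2}`, with `P = A^{1/2} B A^{1/2}`, turns the block
definition of `M₀` into `M₀ = B^{1/2} U + (B/A)^{1/2}`. Hence `G₀* M₀ = P^{1/2}` is nonnegative and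
`M₀ M₀* = B` (`greenM_spec`), so that `Σ₀ = V V*`, and expanding blocks gives `Q_ε = V* Σ_ε V`
(`adjoint_jointFactor_comp_jointCov`).

The entropic problem decouples in an eigenbasis of `G₀* M₀`. For an eigenvalue `p`, the scalar
function `2 p r + ε log (1 - r²)` is stationary at `r = f_ε(p)`. Jensen's inequality bounds the
log-determinant of an arbitrary competitor by scalar tangent lines in this basis, and completing the
square leaves a strict gap (`exists_entropicArgmax`). The maximizer is a self-adjoint contraction,
which makes `Σ_ε` nonnegative.

For the distance, write `N = Σ_ε^{1/2}`. A coupling of `N(0, S)` and `N(0, V V*)` induces operators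
`Z`, `W` into `L²` with `‖Z a‖ = ‖S^{1/2} a‖` and `‖W a‖ = ‖V* a‖`, and its cost is the squared
Hilbert-Schmidt norm of `Z - W`. The cross term is at most `tr (V* S V)^{1/2}`, by Cauchy-Schwarz on
an eigenbasis of that root (`le_cost_of_coupling`). Equality is attained by driving both Gaussian
vectors with the same white noise, rotated by the polar factor of `N V`, and adding independent
noise on the complement (`exists_optimal_coupling`). Taking `S = Σ_ε`, both covariances have trace
`tr A + tr B`, because off-diagonal blocks do not contribute; this yields the formula. -/

theorem hasSum_sq_inner {ι : Type*} (b : HilbertBasis ι ℝ E) (x : E) :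
    HasSum (fun i => ⟪b i, x⟫_ℝ ^ 2) (‖x‖ ^ 2) := by
  have h := b.hasSum_inner_mul_inner x x
  rw [real_inner_self_eq_norm_sq] at h
  refine h.congr_fun fun i => ?_
  rw [real_inner_comm, sq]

/-- Hilbert-Schmidt operators between Hilbert spaces. -/
def HilbertSchmidt (T : E →L[ℝ] F) : Prop := Summable fun i => ‖T (someBasis E i)‖ ^ 2

theorem summable_sq_inner_prod {ι κ : Type*} (b : HilbertBasis ι ℝ E) (c : HilbertBasis κ ℝ F)
    {T : E →L[ℝ] F} (h : Summable fun i => ‖T (b i)‖ ^ 2) :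
    Summable fun p : ι × κ => ⟪c p.2, T (b p.1)⟫_ℝ ^ 2 := by
  have h0 : 0 ≤ fun p : ι × κ => ⟪c p.2, T (b p.1)⟫_ℝ ^ 2 := fun p => sq_nonneg _
  refine (summable_prod_of_nonneg h0).2 ⟨fun i => (hasSum_sq_inner c (T (b i))).summable, ?_⟩
  exact h.congr fun i => (hasSum_sq_inner c (T (b i))).tsum_eq.symm

/-- Parseval in both directions: the double series of `⟪c k, T (b i)⟫²` is summed in the other
order. As the two bases are arbitrary, applying this twice shows that the Hilbert-Schmidt property
does not depend on the basis. -/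
theorem summable_sq_norm_adjoint {ι κ : Type*} (b : HilbertBasis ι ℝ E) (c : HilbertBasis κ ℝ F)
    {T : E →L[ℝ] F} (h : Summable fun i => ‖T (b i)‖ ^ 2) :
    Summable fun k => ‖adjoint T (c k)‖ ^ 2 := by
  have h1 : Summable fun p : κ × ι => ⟪c p.1, T (b p.2)⟫_ℝ ^ 2 :=
    (summable_sq_inner_prod b c h).prod_symm
  have h0 : 0 ≤ fun p : κ × ι => ⟪c p.1, T (b p.2)⟫_ℝ ^ 2 := fun p => sq_nonneg _
  refine ((summable_prod_of_nonneg h0).1 h1).2.congr fun k => ?_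
  rw [← (hasSum_sq_inner b (adjoint T (c k))).tsum_eq]
  refine tsum_congr fun i => ?_
  rw [ContinuousLinearMap.adjoint_inner_right, real_inner_comm]

theorem HilbertSchmidt.summable {ι : Type*} {T : E →L[ℝ] F} (h : HilbertSchmidt T)
    (b : HilbertBasis ι ℝ E) : Summable fun i => ‖T (b i)‖ ^ 2 := by
  have h1 := summable_sq_norm_adjoint (someBasis E) (someBasis F) h
  simpa using summable_sq_norm_adjoint (someBasis F) b h1

theorem HilbertSchmidt.of_summable {ι : Type*} {T : E →L[ℝ] F} (b : HilbertBasis ι ℝ E)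
    (h : Summable fun i => ‖T (b i)‖ ^ 2) : HilbertSchmidt T := by
  have h1 := summable_sq_norm_adjoint b (someBasis F) h
  have h2 := summable_sq_norm_adjoint (someBasis F) (someBasis E) h1
  rw [ContinuousLinearMap.adjoint_adjoint] at h2
  exact h2

theorem HilbertSchmidt.adjoint {T : E →L[ℝ] F} (h : HilbertSchmidt T) :
    HilbertSchmidt (adjoint T) :=
  summable_sq_norm_adjoint (someBasis E) (someBasis F) h

theorem HilbertSchmidt.of_norm_le {G : Type*} [NormedAddCommGroup G] [InnerProductSpace ℝ G]
    [CompleteSpace G] {T : E →L[ℝ] F} {S : E →L[ℝ] G} (h : HilbertSchmidt T) (C : ℝ)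
    (hS : ∀ x, ‖S x‖ ≤ C * ‖T x‖) : HilbertSchmidt S := by
  refine Summable.of_nonneg_of_le (fun i => sq_nonneg _) (fun i => ?_) (Summable.mul_left (C ^ 2) h)
  rw [← mul_pow]
  exact pow_le_pow_left₀ (norm_nonneg _) (hS _) 2

theorem HilbertSchmidt.comp_left {T : E →L[ℝ] F} (h : HilbertSchmidt T) (S : F →L[ℝ] K) :
    HilbertSchmidt (S ∘L T) :=
  h.of_norm_le ‖S‖ fun x => S.le_opNorm (T x)

theorem HilbertSchmidt.comp_right {T : F →L[ℝ] K} (h : HilbertSchmidt T) (S : E →L[ℝ] F) :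
    HilbertSchmidt (T ∘L S) := by
  have := (h.adjoint.comp_left (ContinuousLinearMap.adjoint S)).adjoint
  rwa [← ContinuousLinearMap.adjoint_comp, ContinuousLinearMap.adjoint_adjoint] at this

theorem HilbertSchmidt.isHilbertSchmidt {T : E →L[ℝ] E} (h : HilbertSchmidt T) :
    IsHilbertSchmidt T := fun _ b => h.summable b

theorem HilbertSchmidt.add {S T : E →L[ℝ] F} (hS : HilbertSchmidt S) (hT : HilbertSchmidt T) :
    HilbertSchmidt (S + T) := by
  refine Summable.of_nonneg_of_le (fun i => sq_nonneg _) (fun i => ?_)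
    ((Summable.add hS hT).mul_left 2)
  have h := norm_add_le (S (someBasis E i)) (T (someBasis E i))
  have h0 := norm_nonneg (S (someBasis E i) + T (someBasis E i))
  rw [_root_.add_apply]
  nlinarith [sq_nonneg (‖S (someBasis E i)‖ - ‖T (someBasis E i)‖)]

theorem summable_inner_prod {ι κ : Type*} (b : HilbertBasis ι ℝ E) (c : HilbertBasis κ ℝ F)
    {S T : E →L[ℝ] F} (hS : HilbertSchmidt S) (hT : HilbertSchmidt T) :
    Summable fun p : ι × κ => ⟪S (b p.1), c p.2⟫_ℝ * ⟪c p.2, T (b p.1)⟫_ℝ := by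
  refine Summable.of_norm_bounded ((summable_sq_inner_prod b c (hS.summable b)).add
    (summable_sq_inner_prod b c (hT.summable b))) fun p => ?_
  rw [real_inner_comm, Real.norm_eq_abs, abs_mul]
  nlinarith [sq_nonneg (|⟪c p.2, S (b p.1)⟫_ℝ| - |⟪c p.2, T (b p.1)⟫_ℝ|),
    sq_abs ⟪c p.2, S (b p.1)⟫_ℝ, sq_abs ⟪c p.2, T (b p.1)⟫_ℝ, sq_nonneg ⟪c p.2, S (b p.1)⟫_ℝ,
    sq_nonneg ⟪c p.2, T (b p.1)⟫_ℝ]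

/-- The Hilbert-Schmidt inner product `tr (S* T)`. -/
def hsInner (S T : E →L[ℝ] F) : ℝ := ∑' i, ⟪S (someBasis E i), T (someBasis E i)⟫_ℝ

theorem hasSum_inner_swap {ι κ : Type*} (b : HilbertBasis ι ℝ E) (c : HilbertBasis κ ℝ F)
    {S T : E →L[ℝ] F} (hS : HilbertSchmidt S) (hT : HilbertSchmidt T) :
    (Summable fun i => ⟪S (b i), T (b i)⟫_ℝ) ∧
    HasSum (fun k => ⟪adjoint T (c k), adjoint S (c k)⟫_ℝ) (∑' i, ⟪S (b i), T (b i)⟫_ℝ) := by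
  have h := summable_inner_prod b c hS hT
  have h1 : HasSum (fun i => ⟪S (b i), T (b i)⟫_ℝ) _ := h.hasSum.prod_fiberwise fun i =>
    c.hasSum_inner_mul_inner (S (b i)) (T (b i))
  refine ⟨h1.summable, ?_⟩
  rw [h1.tsum_eq]
  have h2 := h.prod_symm.hasSum
  have e : ∑' p : ι × κ, ⟪S (b p.1), c p.2⟫_ℝ * ⟪c p.2, T (b p.1)⟫_ℝ
      = ∑' p : κ × ι, ⟪S (b p.swap.1), c p.swap.2⟫_ℝ * ⟪c p.swap.2, T (b p.swap.1)⟫_ℝ :=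
    ((Equiv.prodComm κ ι).tsum_eq
      (fun p : ι × κ => ⟪S (b p.1), c p.2⟫_ℝ * ⟪c p.2, T (b p.1)⟫_ℝ)).symm
  rw [e]
  refine h2.prod_fiberwise fun k => ?_
  refine (b.hasSum_inner_mul_inner (adjoint T (c k)) (adjoint S (c k))).congr_fun fun i => ?_
  simp only [Prod.swap, ContinuousLinearMap.adjoint_inner_right,
    ContinuousLinearMap.adjoint_inner_left]
  ring

theorem hasSum_hsInner {ι : Type*} (b : HilbertBasis ι ℝ E) {S T : E →L[ℝ] F}
    (hS : HilbertSchmidt S) (hT : HilbertSchmidt T) :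
    HasSum (fun i => ⟪S (b i), T (b i)⟫_ℝ) (hsInner S T) := by
  have h1 := (hasSum_inner_swap (someBasis E) (someBasis F) hS hT).2
  have h2 := (hasSum_inner_swap (someBasis F) b hT.adjoint hS.adjoint).2
  simp only [ContinuousLinearMap.adjoint_adjoint] at h2
  rwa [h1.tsum_eq] at h2

theorem hsInner_adjoint {S T : E →L[ℝ] F} (hS : HilbertSchmidt S) (hT : HilbertSchmidt T) :
    hsInner (adjoint T) (adjoint S) = hsInner S T :=
  (hasSum_inner_swap (someBasis E) (someBasis F) hS hT).2.tsum_eq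

theorem trace_adjoint_comp (S T : E →L[ℝ] F) : trace (adjoint S ∘L T) = hsInner S T :=
  tsum_congr fun i => by
    rw [ContinuousLinearMap.comp_apply, ContinuousLinearMap.adjoint_inner_right]

theorem hsInner_comm (S T : E →L[ℝ] F) : hsInner S T = hsInner T S :=
  tsum_congr fun _ => real_inner_comm _ _

theorem hsInner_comp_left (S : E →L[ℝ] F) (T : E →L[ℝ] K) (C : K →L[ℝ] F) :
    hsInner S (C ∘L T) = hsInner (adjoint C ∘L S) T :=
  tsum_congr fun i => by
    rw [ContinuousLinearMap.comp_apply, ContinuousLinearMap.comp_apply,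
      ContinuousLinearMap.adjoint_inner_left]

/-- Cyclicity of the trace: passing to adjoints turns a right factor into a left factor, which moves
across termwise. -/
theorem hsInner_comp_right {S : E →L[ℝ] F} {T : K →L[ℝ] F} (hS : HilbertSchmidt S)
    (hT : HilbertSchmidt T) (C : E →L[ℝ] K) :
    hsInner S (T ∘L C) = hsInner (S ∘L adjoint C) T := by
  rw [← hsInner_adjoint hS (hT.comp_right C), ContinuousLinearMap.adjoint_comp,
    hsInner_comm, hsInner_comp_left, ← hsInner_adjoint (hS.comp_right _) hT,
    ContinuousLinearMap.adjoint_comp, hsInner_comm]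

theorem hsInner_self_nonneg (T : E →L[ℝ] F) : 0 ≤ hsInner T T :=
  tsum_nonneg fun _ => real_inner_self_nonneg

theorem norm_apply_sq_le_hsInner {T : E →L[ℝ] F} (h : HilbertSchmidt T) (x : E) :
    ‖T x‖ ^ 2 ≤ hsInner T T * ‖x‖ ^ 2 := by
  have h1 := hasSum_sq_inner (someBasis F) (T x)
  have h2 := (hasSum_hsInner (someBasis F) h.adjoint h.adjoint).mul_right (‖x‖ ^ 2)
  rw [hsInner_adjoint h h] at h2
  refine hasSum_le (fun k => ?_) h1 h2
  rw [← ContinuousLinearMap.adjoint_inner_left, real_inner_self_eq_norm_sq, ← mul_pow, sq_le_sq,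
    abs_of_nonneg (mul_nonneg (norm_nonneg _) (norm_nonneg _))]
  exact abs_real_inner_le_norm _ _

/-- A Hilbert-Schmidt operator is compact. -/
theorem HilbertSchmidt.isCompactOperator {T : E →L[ℝ] F} (h : HilbertSchmidt T) :
    IsCompactOperator T := by
  classical
  let b := someBasis E
  -- Finite-rank truncations along the basis. The squared Hilbert-Schmidt norm of `T - Tn s` is a
  -- tail of a convergent series and dominates the squared operator norm, so `T` is a norm limit of
  -- compact operators.
  let Tn : Finset _ → (E →L[ℝ] F) := fun s => ∑ i ∈ s, (innerSL ℝ (b i)).smulRight (T (b i))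
  have hcomp : ∀ s, IsCompactOperator (Tn s) := by
    intro s
    have : Tn s ∈ compactOperator (RingHom.id ℝ) E F := by
      refine Submodule.sum_mem _ fun i _ => ?_
      have h1 : IsCompactOperator (ContinuousLinearMap.toSpanSingleton ℝ (T (b i)) : ℝ →L[ℝ] F) :=
        isCompactOperator_of_locallyCompactSpace_rng _
      exact h1.comp_clm (innerSL ℝ (b i))
    exact this
  refine isCompactOperator_of_tendsto (l := Filter.atTop) (F := Tn) ?_
    (Filter.Eventually.of_forall hcomp)
  have hsub : ∀ s i, (T - Tn s) (b i) = if i ∈ s then 0 else T (b i) := by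
    intro s i
    have h1 : Tn s (b i) = if i ∈ s then T (b i) else 0 := by
      simp only [Tn, _root_.sum_apply, ContinuousLinearMap.smulRight_apply,
        innerSL_apply_apply, orthonormal_iff_ite.1 b.orthonormal, ite_smul, one_smul, zero_smul,
        Finset.sum_ite_eq']
    rw [_root_.sub_apply, h1]
    split_ifs <;> simp
  have hnorm : ∀ s, (fun i => ‖(T - Tn s) (b i)‖ ^ 2)
      = (s : Set _)ᶜ.indicator fun i => ‖T (b i)‖ ^ 2 := by
    intro s
    ext i
    rw [hsub, Set.indicator_apply]
    by_cases hi : i ∈ s <;> simp [hi]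
  have hHS : ∀ s, HilbertSchmidt (T - Tn s) := by
    intro s
    change Summable fun i => ‖(T - Tn s) (b i)‖ ^ 2
    rw [hnorm]
    exact Summable.indicator h _
  have hval : ∀ s, hsInner (T - Tn s) (T - Tn s)
      = ∑' i : {i // i ∉ s}, ‖T (b i)‖ ^ 2 := by
    intro s
    simp only [hsInner, real_inner_self_eq_norm_sq]
    change ∑' i, (fun i => ‖(T - Tn s) (b i)‖ ^ 2) i = _
    rw [hnorm, ← tsum_subtype]
    rfl
  have hlim : Filter.Tendsto (fun s => Real.sqrt (hsInner (T - Tn s) (T - Tn s))) Filter.atTop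
      (nhds 0) := by
    simp only [hval]
    rw [← Real.sqrt_zero]
    exact (tendsto_tsum_compl_atTop_zero fun i => ‖T (b i)‖ ^ 2).sqrt
  rw [tendsto_iff_norm_sub_tendsto_zero]
  refine squeeze_zero (fun s => norm_nonneg _) (fun s => ?_) hlim
  rw [norm_sub_rev]
  refine ContinuousLinearMap.opNorm_le_bound _ (Real.sqrt_nonneg _) fun x => ?_
  refine le_of_sq_le_sq ?_ (mul_nonneg (Real.sqrt_nonneg _) (norm_nonneg _))
  rw [mul_pow, Real.sq_sqrt (hsInner_self_nonneg _)]
  exact norm_apply_sq_le_hsInner (hHS s) x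

end HilbertSchmidtOperators

/-! ### Eigenbases and nonnegative square roots -/

section Spectral

universe u

variable {H : Type u} [NormedAddCommGroup H] [InnerProductSpace ℝ H] [CompleteSpace H]

/-- Spectral theorem: a compact self-adjoint operator has an orthonormal basis of eigenvectors. -/
theorem exists_eigenbasis {T : H →L[ℝ] H} (hT : IsSelfAdjoint T) (hc : IsCompactOperator T) :
    ∃ (ι : Type u) (b : HilbertBasis ι ℝ H) (t : ι → ℝ), ∀ i, T (b i) = t i • b i := by
  have hsym : (T : H →ₗ[ℝ] H).IsSymmetric := hT.isSymmetric
  let V : ℝ → Submodule ℝ H := fun μ => Module.End.eigenspace (T : H →ₗ[ℝ] H) μ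
  have hV : OrthogonalFamily ℝ (fun μ => V μ) fun μ => (V μ).subtypeₗᵢ :=
    hsym.orthogonalFamily_eigenspaces
  have hcl : ∀ μ, CompleteSpace (V μ) := by
    intro μ
    have : (V μ : Set H) = {x | T x = μ • x} := by
      ext x
      simp [V]
    have h2 : IsClosed (V μ : Set H) := by
      rw [this]
      exact isClosed_eq (by fun_prop) (by fun_prop)
    exact h2.completeSpace_coe
  let v : (Σ μ, (exists_hilbertBasis ℝ (V μ)).choose) → H := fun a => (someBasis (V a.1) a.2 : H)
  have hv : Orthonormal ℝ v :=
    hV.orthonormal_sigma_orthonormal fun μ => (someBasis (V μ)).orthonormal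
  -- A vector orthogonal to a basis of each eigenspace is orthogonal to all eigenspaces, and for a
  -- compact self-adjoint operator only zero is.
  have hbot : (Submodule.span ℝ (Set.range v))ᗮ = ⊥ := by
    rw [eq_bot_iff, ← ContinuousLinearMap.orthogonalComplement_iSup_eigenspaces_eq_bot hc hsym]
    refine fun x hx => ?_
    rw [Submodule.mem_orthogonal'] at hx ⊢
    intro y hy
    refine Submodule.iSup_induction V (motive := fun y => ⟪x, y⟫_ℝ = 0) hy ?_ (inner_zero_right _)
      (fun y z hy hz => by rw [inner_add_right, hy, hz, add_zero])
    intro μ y hy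
    have h1 := ((someBasis (V μ)).hasSum_repr ⟨y, hy⟩).mapL (V μ).subtypeL
    have h2 := h1.mapL (innerSL ℝ x)
    refine h2.unique ?_
    convert hasSum_zero with i
    rw [map_smul, map_smul, innerSL_apply_apply]
    have := hx (v ⟨μ, i⟩) (Submodule.subset_span ⟨_, rfl⟩)
    simp only [v] at this
    rw [Submodule.subtypeL_apply, this, smul_zero]
  refine ⟨_, HilbertBasis.mkOfOrthogonalEqBot hv hbot, fun a => a.1, fun a => ?_⟩
  rw [HilbertBasis.coe_mkOfOrthogonalEqBot]
  exact Module.End.mem_eigenspace_iff.1 (someBasis (V a.1) a.2).2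

theorem ext_hilbertBasis {ι : Type*} {F : Type*} [NormedAddCommGroup F] [NormedSpace ℝ F]
    (b : HilbertBasis ι ℝ H) {S T : H →L[ℝ] F} (h : ∀ i, S (b i) = T (b i)) : S = T := by
  refine ContinuousLinearMap.ext_on (s := Set.range b) ?_ ?_
  · exact Submodule.dense_iff_topologicalClosure_eq_top.2 b.dense_span
  · rintro _ ⟨i, rfl⟩
    exact h i

/-- For `c > 0`, the vector `y = S x - c x` satisfies `S y = -c y`, so positivity forces `y = 0`.
This gives uniqueness of the square root on eigenvectors. -/
theorem isPositive_sqrt_apply {S : H →L[ℝ] H} (hS : S.IsPositive) {c : ℝ} (hc : 0 ≤ c) {x : H}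
    (h : S (S x) = c ^ 2 • x) : S x = c • x := by
  have hsym : ∀ u v, ⟪S u, v⟫_ℝ = ⟪u, S v⟫_ℝ := fun u v => hS.isSelfAdjoint.isSymmetric u v
  rcases hc.eq_or_lt with rfl | hc
  · have : ⟪S x, S x⟫_ℝ = 0 := by rw [← hsym, h]; simp
    rw [inner_self_eq_zero.1 this, zero_smul]
  · have h1 := hS.inner_nonneg_left (S x - c • x)
    have h2 : S (S x - c • x) = -c • (S x - c • x) := by
      rw [map_sub, map_smul, h]
      module
    rw [h2, real_inner_smul_left, real_inner_self_eq_norm_sq] at h1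
    have h3 : ‖S x - c • x‖ = 0 := by
      have := sq_nonneg ‖S x - c • x‖
      have : ‖S x - c • x‖ ^ 2 = 0 := by nlinarith
      simpa using this
    exact sub_eq_zero.1 (norm_eq_zero.1 h3)

theorem opSqrt_isPositive {T : H →L[ℝ] H} (hT : T.IsPositive) : (opSqrt T).IsPositive :=
  (opSqrt_spec T hT).1

theorem opSqrt_comp_self {T : H →L[ℝ] H} (hT : T.IsPositive) : opSqrt T ∘L opSqrt T = T :=
  (opSqrt_spec T hT).2

theorem opSqrt_apply_apply {T : H →L[ℝ] H} (hT : T.IsPositive) (x : H) :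
    opSqrt T (opSqrt T x) = T x := by
  rw [← ContinuousLinearMap.comp_apply, opSqrt_comp_self hT]

theorem adjoint_opSqrt {T : H →L[ℝ] H} (hT : T.IsPositive) : adjoint (opSqrt T) = opSqrt T :=
  (opSqrt_isPositive hT).isSelfAdjoint.adjoint_eq

theorem norm_opSqrt_sq {T : H →L[ℝ] H} (hT : T.IsPositive) (x : H) :
    ‖opSqrt T x‖ ^ 2 = ⟪x, T x⟫_ℝ := by
  rw [← real_inner_self_eq_norm_sq, ← ContinuousLinearMap.adjoint_inner_right, adjoint_opSqrt hT,
    opSqrt_apply_apply hT]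

theorem hilbertSchmidt_opSqrt {T : H →L[ℝ] H} (hT : T.IsPositive)
    (h : Summable fun i => ⟪someBasis H i, T (someBasis H i)⟫_ℝ) : HilbertSchmidt (opSqrt T) := by
  refine Summable.congr h fun i => ?_
  rw [norm_opSqrt_sq hT]

/-- The trace class condition concerns `|A|`, so `|A| = A` is needed. The root of `|A|` is
Hilbert-Schmidt, hence `|A|` is compact and has an eigenbasis; there `A` agrees with `|A|`, both
being nonnegative roots of `A²`. -/
theorem IsCovariance.hilbertSchmidt_opSqrt {A : H →L[ℝ] H} (hA : IsCovariance A) :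
    HilbertSchmidt (opSqrt A) := by
  have hpos : (adjoint A ∘L A).IsPositive := ContinuousLinearMap.isPositive_adjoint_comp_self A
  set S := opSqrt (adjoint A ∘L A) with hS
  have hSpos : S.IsPositive := opSqrt_isPositive hpos
  have hS2 : ∀ x, S (S x) = A (A x) := fun x => by
    rw [hS, opSqrt_apply_apply hpos, hA.1.isSelfAdjoint.adjoint_eq, ContinuousLinearMap.comp_apply]
  have h1 : Summable fun i => ⟪someBasis H i, S (someBasis H i)⟫_ℝ := hA.2 _ (someBasis H)
  have h2 := GaussianEOT.hilbertSchmidt_opSqrt hSpos h1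
  have h3 : HilbertSchmidt S := by
    have := h2.comp_left (opSqrt S)
    rwa [opSqrt_comp_self hSpos] at this
  obtain ⟨ι, b, t, ht⟩ := exists_eigenbasis hSpos.isSelfAdjoint h3.isCompactOperator
  have h4 : A = S := by
    refine ext_hilbertBasis b fun i => ?_
    have h0 : 0 ≤ t i := by
      have := hSpos.inner_nonneg_left (b i)
      rw [ht, real_inner_smul_left, real_inner_self_eq_norm_sq, b.orthonormal.1 i] at this
      simpa using this
    rw [ht]
    refine isPositive_sqrt_apply hA.1 h0 ?_
    rw [← hS2, ht, map_smul, ht, smul_smul, sq]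
  rw [h4]
  exact h2

end Spectral

/-! ### Partial isometries -/

section PolarDecomposition

variable {E F K : Type*} [NormedAddCommGroup E] [InnerProductSpace ℝ E] [CompleteSpace E]
  [NormedAddCommGroup F] [InnerProductSpace ℝ F] [CompleteSpace F]
  [NormedAddCommGroup K] [InnerProductSpace ℝ K] [CompleteSpace K]

/-- Operators with `‖T x‖ = ‖S x‖` differ by a partial isometry on the closure of the range. -/
theorem exists_partialIsometry (T : E →L[ℝ] F) (S : E →L[ℝ] K) (h : ∀ x, ‖T x‖ = ‖S x‖) :
    ∃ U : K →L[ℝ] F, U ∘L S = T ∧ adjoint U ∘L U ∘L S = S ∧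
      (∀ y ∈ (LinearMap.range (S : E →ₗ[ℝ] K))ᗮ, U y = 0) ∧
      adjoint U ∘L U ∘L adjoint U = adjoint U ∧ ∀ y, ‖U y‖ ≤ ‖y‖ := by
  set R := (LinearMap.range (S : E →ₗ[ℝ] K)).topologicalClosure with hR
  have hRc : IsClosed (R : Set K) := Submodule.isClosed_topologicalClosure _
  have : CompleteSpace R := hRc.completeSpace_coe
  have hmem : ∀ x, S x ∈ R := fun x => Submodule.le_topologicalClosure _ ⟨x, rfl⟩
  let e : E →ₗ[ℝ] R := LinearMap.codRestrict R (S : E →ₗ[ℝ] K) hmem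
  have hd : DenseRange e := by
    intro y
    rw [closure_subtype]
    have h1 : (fun z : R => (z : K)) '' Set.range e
        = (LinearMap.range (S : E →ₗ[ℝ] K) : Set K) := by
      ext z
      simp [e]
    have h2 : (y : K) ∈ closure (LinearMap.range (S : E →ₗ[ℝ] K) : Set K) := y.2
    rwa [← h1] at h2
  have hn : ∀ x, ‖(T : E →ₗ[ℝ] F) x‖ ≤ 1 * ‖e x‖ := fun x => by
    rw [one_mul]
    exact (h x).le
  -- Equality of norms makes `S x ↦ T x` a well-defined isometry on the range of `S`. It extends to
  -- the closure `R`, and setting it to zero on `Rᗮ` makes `U* U` the projection onto `R`.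
  let V : R →L[ℝ] F := (T : E →ₗ[ℝ] F).extendOfNorm e
  have hV : ∀ x, V (e x) = T x := fun x => LinearMap.extendOfNorm_eq hd ⟨1, hn⟩ x
  have hiso : ∀ y, ‖V y‖ = ‖y‖ := by
    intro y
    refine hd.induction_on (p := fun y => ‖V y‖ = ‖y‖) y ?_ ?_
    · exact isClosed_eq (by fun_prop) (by fun_prop)
    · intro x
      rw [hV]
      exact h x
  let U : K →L[ℝ] F := V ∘L R.orthogonalProjectionOnto
  have hUR : ∀ y : R, U y = V y := fun y => by simp [U]
  have hU0 : ∀ y ∈ Rᗮ, U y = 0 := fun y hy => by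
    simp only [U, ContinuousLinearMap.comp_apply]
    rw [Submodule.orthogonalProjectionOnto_apply_of_mem_orthogonal hy, map_zero]
  have hUU : adjoint U ∘L U = R.starProjection := by
    refine ContinuousLinearMap.ext fun y => ext_inner_left ℝ fun x => ?_
    have h1 := LinearIsometry.inner_map_map ⟨V.toLinearMap, hiso⟩
      (R.orthogonalProjectionOnto x) (R.orthogonalProjectionOnto y)
    rw [ContinuousLinearMap.comp_apply, ContinuousLinearMap.adjoint_inner_right]
    refine h1.trans ?_
    change ⟪R.starProjection x, R.starProjection y⟫_ℝ = _
    rw [Submodule.inner_starProjection_left_eq_right,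
      Submodule.starProjection_eq_self_iff.2 (Submodule.starProjection_apply_mem R y)]
  refine ⟨U, ?_, ?_, ?_, ?_, ?_⟩
  · ext x
    exact (hUR (e x)).trans (hV x)
  · rw [← ContinuousLinearMap.comp_assoc, hUU]
    ext x
    exact Submodule.starProjection_eq_self_iff.2 (hmem x)
  · intro y hy
    exact hU0 y (by rwa [hR, Submodule.orthogonal_closure])
  · have : U ∘L adjoint U ∘L U = U := by
      rw [hUU]
      ext y
      have h1 := hU0 _ (R.sub_starProjection_mem_orthogonal y)
      rw [map_sub] at h1
      exact (sub_eq_zero.1 h1).symm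
    have h2 := congrArg adjoint this
    simpa [ContinuousLinearMap.adjoint_comp, ContinuousLinearMap.comp_assoc] using h2
  · intro y
    exact (hiso _).trans_le (R.norm_orthogonalProjectionOnto_apply_le y)

end PolarDecomposition

/-! ### The canonical Green's operators -/

section GreenOperators

variable {H : Type*} [NormedAddCommGroup H] [InnerProductSpace ℝ H] [CompleteSpace H]

/-- Two solutions with values in `N(T)ᗮ` differ by an element of `N(T) ∩ N(T)ᗮ = 0`. This identifies
each Moore-Penrose expression with an explicit operator. -/
theorem pinvComp_eq {T S D : H →L[ℝ] H} (h : T ∘L D = S)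
    (hD : ∀ x, D x ∈ (LinearMap.ker (T : H →ₗ[ℝ] H))ᗮ) : pinvComp T S = D := by
  have hr : ∀ x, ∃ y, T y = S x := fun x => ⟨D x, by rw [← h]; rfl⟩
  obtain ⟨h1, h2⟩ := pinvComp_spec T S hr
  ext x
  have h3 : pinvComp T S x - D x ∈ LinearMap.ker (T : H →ₗ[ℝ] H) := by
    rw [LinearMap.mem_ker, ContinuousLinearMap.coe_coe, map_sub, ← ContinuousLinearMap.comp_apply,
      ← ContinuousLinearMap.comp_apply, h1, h, sub_self]
  exact sub_eq_zero.1 ((Submodule.disjoint_def.1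
    (LinearMap.ker (T : H →ₗ[ℝ] H)).orthogonal_disjoint) _ h3 (Submodule.sub_mem _ (h2 x) (hD x)))

theorem ker_opSqrt {A : H →L[ℝ] H} (hA : A.IsPositive) :
    LinearMap.ker (opSqrt A : H →ₗ[ℝ] H) = LinearMap.ker (A : H →ₗ[ℝ] H) := by
  ext x
  rw [LinearMap.mem_ker, LinearMap.mem_ker, ContinuousLinearMap.coe_coe,
    ContinuousLinearMap.coe_coe]
  constructor
  · intro h
    rw [← opSqrt_apply_apply hA, h, map_zero]
  · intro h
    have := norm_opSqrt_sq hA x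
    rw [h, inner_zero_right] at this
    simpa using this

theorem isClosed_ker (A : H →L[ℝ] H) : CompleteSpace (LinearMap.ker (A : H →ₗ[ℝ] H)) :=
  A.isClosed_ker.completeSpace_coe

theorem apply_kerProj (A : H →L[ℝ] H) (x : H) : A (kerProj A x) = 0 :=
  LinearMap.mem_ker.1 (Submodule.starProjection_apply_mem (LinearMap.ker (A : H →ₗ[ℝ] H)) x)

theorem adjoint_kerProj (A : H →L[ℝ] H) : adjoint (kerProj A) = kerProj A := by
  refine (ContinuousLinearMap.eq_adjoint_iff _ _).2 (fun x y => ?_) |>.symm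
  exact Submodule.inner_starProjection_left_eq_right _ x y

theorem crossOp_eq {A B : H →L[ℝ] H} (hA : A.IsPositive) (hB : B.IsPositive) :
    crossOp A B = adjoint (opSqrt B ∘L opSqrt A) ∘L (opSqrt B ∘L opSqrt A) := by
  rw [ContinuousLinearMap.adjoint_comp, adjoint_opSqrt hA, adjoint_opSqrt hB]
  ext x
  simp [crossOp, opSqrt_apply_apply hB]

theorem crossOp_isPositive {A B : H →L[ℝ] H} (hA : A.IsPositive) (hB : B.IsPositive) :
    (crossOp A B).IsPositive := by
  rw [crossOp_eq hA hB]
  exact ContinuousLinearMap.isPositive_adjoint_comp_self _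

theorem schurOp_isPositive (A : H →L[ℝ] H) {B : H →L[ℝ] H} (hB : B.IsPositive) :
    (schurOp A B).IsPositive := by
  set N := opSqrt A ∘L opSqrt B
  have : schurOp A B = adjoint (kerProj N ∘L opSqrt B) ∘L (kerProj N ∘L opSqrt B) := by
    rw [ContinuousLinearMap.adjoint_comp, adjoint_kerProj, adjoint_opSqrt hB]
    ext x
    simp only [schurOp, ContinuousLinearMap.comp_apply]
    congr 1
    exact (Submodule.starProjection_eq_self_iff.2 (Submodule.starProjection_apply_mem _ _)).symm
  rw [this]
  exact ContinuousLinearMap.isPositive_adjoint_comp_self _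

/-- `A^{1/2} B^{1/2}` annihilates the range of the projection in the Schur operator. By
self-adjointness the Schur operator vanishes on `R(A^{1/2})`, and then so does its root, since
`‖T^{1/2} x‖² = ⟪x, T x⟫`. -/
theorem opSqrt_comp_opSqrt_schurOp {A B : H →L[ℝ] H} (hA : A.IsPositive) (hB : B.IsPositive) :
    opSqrt A ∘L opSqrt (schurOp A B) = 0 := by
  have hS := schurOp_isPositive A hB
  have h1 : opSqrt A ∘L schurOp A B = 0 := by
    ext x
    exact apply_kerProj (opSqrt A ∘L opSqrt B) (opSqrt B x)
  have h2 : schurOp A B ∘L opSqrt A = 0 := by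
    have := congrArg adjoint h1
    rwa [ContinuousLinearMap.adjoint_comp, adjoint_opSqrt hA, hS.isSelfAdjoint.adjoint_eq,
      map_zero] at this
  have h3 : opSqrt (schurOp A B) ∘L opSqrt A = 0 := by
    ext x
    have h4 := norm_opSqrt_sq hS (opSqrt A x)
    have h5 : schurOp A B (opSqrt A x) = 0 := congrArg (fun T => T x) h2
    rw [h5, inner_zero_right] at h4
    simpa using h4
  have := congrArg adjoint h3
  rwa [ContinuousLinearMap.adjoint_comp, adjoint_opSqrt hA, adjoint_opSqrt hS, map_zero] at this

/-- With `B^{1/2} A^{1/2} = U P^{1/2}` the polar decomposition, `M₀ = B^{1/2} U + (B/A)^{1/2}`. -/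
theorem greenM_spec {A B : H →L[ℝ] H} (hA : A.IsPositive) (hB : B.IsPositive) :
    adjoint (greenG A) ∘L greenM A B = opSqrt (crossOp A B) ∧
      greenM A B ∘L adjoint (greenM A B) = B := by
  have hP := crossOp_isPositive hA hB
  have hS := schurOp_isPositive A hB
  set S := opSqrt (schurOp A B) with hSdef
  have hAS := opSqrt_comp_opSqrt_schurOp hA hB
  set a := opSqrt A with ha
  set b := opSqrt B with hb
  set P := opSqrt (crossOp A B) with hPdef
  have haa : adjoint a = a := adjoint_opSqrt hA
  have hba : adjoint b = b := adjoint_opSqrt hB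
  have hPa : adjoint P = P := adjoint_opSqrt hP
  have hSa : adjoint S = S := adjoint_opSqrt hS
  have hnorm : ∀ x, ‖(b ∘L a) x‖ = ‖P x‖ := by
    intro x
    have h1 : ‖(b ∘L a) x‖ ^ 2 = ‖P x‖ ^ 2 := by
      rw [norm_opSqrt_sq hP, crossOp_eq hA hB, ContinuousLinearMap.comp_apply (adjoint _),
        ContinuousLinearMap.adjoint_inner_right, real_inner_self_eq_norm_sq]
    exact (pow_left_inj₀ (norm_nonneg _) (norm_nonneg _) two_ne_zero).1 h1
  obtain ⟨U, hUP, hUUP, hU0, hUUU, -⟩ := exists_partialIsometry (b ∘L a) P hnorm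
  have hUk : ∀ z, P z = 0 → U z = 0 := by
    intro z hz
    refine hU0 z ?_
    rw [Submodule.mem_orthogonal]
    rintro _ ⟨y, rfl⟩
    rw [ContinuousLinearMap.coe_coe, ← ContinuousLinearMap.adjoint_inner_right, hPa, hz,
      inner_zero_right]
  have hPU : P ∘L adjoint U = a ∘L b := by
    have := congrArg adjoint hUP
    rwa [ContinuousLinearMap.adjoint_comp, ContinuousLinearMap.adjoint_comp, hPa, haa, hba] at this
  have habU : a ∘L b ∘L U = P := by
    have := congrArg adjoint hUUP
    rw [ContinuousLinearMap.adjoint_comp, ContinuousLinearMap.adjoint_comp,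
      ContinuousLinearMap.adjoint_adjoint, hPa, hPU] at this
    exact this
  have haK : ∀ x, a (kerProj A x) = 0 := fun x => by
    have h1 : kerProj A x ∈ LinearMap.ker (a : H →ₗ[ℝ] H) := by
      rw [ha, ker_opSqrt hA]
      exact apply_kerProj A x
    exact h1
  -- `B^{1/2} U` solves `A^{1/2} D = P^{1/2}`; removing its component in `N(A)` gives the solution
  -- with range in `N(A)ᗮ`.
  have hM1 : pinvComp a P = b ∘L U - kerProj A ∘L b ∘L U := by
    refine pinvComp_eq ?_ fun x => ?_
    · ext x
      simp only [ContinuousLinearMap.comp_apply, _root_.sub_apply, map_sub, haK, sub_zero]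
      exact congrArg (fun T => T x) habU
    · rw [ha, ker_opSqrt hA]
      exact Submodule.sub_starProjection_mem_orthogonal (b (U x))
  have hM2 : pinvComp P (a ∘L B ∘L kerProj A) = adjoint U ∘L b ∘L kerProj A := by
    refine pinvComp_eq ?_ fun x => ?_
    · rw [← ContinuousLinearMap.comp_assoc, hPU]
      ext x
      simp [hb, opSqrt_apply_apply hB]
    · rw [Submodule.mem_orthogonal]
      intro z hz
      rw [ContinuousLinearMap.comp_apply, ContinuousLinearMap.adjoint_inner_right, hUk z hz,
        inner_zero_left]
  -- The adjoint of the operator in `hM2` is the projection of `B^{1/2} U` onto `N(A)`, exactly what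
  -- `hM1` subtracted.
  have hM : greenM A B = b ∘L U + S := by
    rw [greenM, ← ha, ← hPdef, ← hSdef, hM1, hM2]
    simp only [ContinuousLinearMap.adjoint_comp, ContinuousLinearMap.adjoint_adjoint,
      adjoint_kerProj, hba]
    rw [ContinuousLinearMap.comp_assoc]
    abel
  constructor
  · rw [hM, greenG, ← ha, haa, ContinuousLinearMap.comp_add, hAS, habU, add_zero]
  · have hUS : U ∘L S = 0 := by
      ext x
      refine hUk _ ?_
      have h1 : a (S x) = 0 := congrArg (fun T => T x) hAS
      rw [← norm_eq_zero, ← hnorm, ContinuousLinearMap.comp_apply, ContinuousLinearMap.coe_coe, h1,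
        map_zero, norm_zero]
    have hSU : S ∘L adjoint U = 0 := by
      have := congrArg adjoint hUS
      rwa [ContinuousLinearMap.adjoint_comp, hSa, map_zero] at this
    -- `1 - U U*` projects onto `N(U*) = N(A^{1/2} B^{1/2})`. So the Schur operator is `B - B^{1/2}
    -- U U* B^{1/2}`, the part of `B` missing from `(B^{1/2} U) (B^{1/2} U)*`.
    have hproj : ∀ z, kerProj (a ∘L b) z = z - U (adjoint U z) := by
      intro z
      refine (Submodule.eq_starProjection_of_mem_orthogonal ?_ ?_)
      · rw [LinearMap.mem_ker, ← hPU, ContinuousLinearMap.coe_coe, map_sub, sub_eq_zero]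
        change P (adjoint U z) = P ((adjoint U ∘L U ∘L adjoint U) z)
        rw [hUUU]
      · rw [sub_sub_cancel, Submodule.mem_orthogonal]
        intro w hw
        rw [LinearMap.mem_ker, ← hPU, ContinuousLinearMap.coe_coe,
          ContinuousLinearMap.comp_apply] at hw
        rw [← ContinuousLinearMap.adjoint_inner_left]
        have h1 := hUk _ hw
        have h2 : adjoint U w = 0 := by
          rw [← inner_self_eq_zero (𝕜 := ℝ), ContinuousLinearMap.adjoint_inner_left, h1,
            inner_zero_right]
        rw [h2, inner_zero_left]
    ext x
    have h1 : U (S x) = 0 := congrArg (fun T => T x) hUS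
    have h2 : S (adjoint U (b x)) = 0 := congrArg (fun T => T (b x)) hSU
    have h3 : S (S x) = b (b x - U (adjoint U (b x))) := by
      rw [hSdef, opSqrt_apply_apply hS, ← hproj]
      rfl
    rw [hM, map_add, ContinuousLinearMap.adjoint_comp, hba, hSa]
    simp only [ContinuousLinearMap.comp_apply, _root_.add_apply, map_add, h1, h2, h3, map_sub,
      map_zero]
    rw [← opSqrt_apply_apply hB x]
    abel

end GreenOperators

/-! ### The logarithm of the Fredholm determinant -/

section FredholmDeterminant

variable {H : Type*} [NormedAddCommGroup H] [InnerProductSpace ℝ H] [CompleteSpace H]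

theorem inner_eigenbasis {ι : Type*} (b : HilbertBasis ι ℝ H) {T : H →L[ℝ] H} {t : ι → ℝ}
    (hT : IsSelfAdjoint T) (ht : ∀ i, T (b i) = t i • b i) (i : ι) (v : H) :
    ⟪b i, T v⟫_ℝ = t i * ⟪b i, v⟫_ℝ := by
  rw [← ContinuousLinearMap.adjoint_inner_left, hT.adjoint_eq, ht, real_inner_smul_left]

theorem ext_inner_hilbertBasis {ι : Type*} (b : HilbertBasis ι ℝ H) {x y : H}
    (h : ∀ i, ⟪b i, x⟫_ℝ = ⟪b i, y⟫_ℝ) : x = y := by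
  have h1 : HasSum (fun _ : ι => (0 : ℝ)) (‖x - y‖ ^ 2) := by
    refine (hasSum_sq_inner b (x - y)).congr_fun fun i => ?_
    rw [inner_sub_right, h, sub_self, zero_pow two_ne_zero]
  have h2 := h1.unique hasSum_zero
  exact sub_eq_zero.1 (by simpa using h2)

theorem finrank_eigenspace_eq_card {ι : Type*} (b : HilbertBasis ι ℝ H) {T : H →L[ℝ] H}
    {t : ι → ℝ} (hT : IsSelfAdjoint T) (ht : ∀ i, T (b i) = t i • b i) (μ : ℝ)
    [Finite {i // t i = μ}] :
    Module.finrank ℝ (Module.End.eigenspace (T : H →ₗ[ℝ] H) μ) = Nat.card {i // t i = μ} := by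
  classical
  have := Fintype.ofFinite {i // t i = μ}
  let v : {i // t i = μ} → H := fun i => b i
  have hv : LinearIndependent ℝ v :=
    b.orthonormal.linearIndependent.comp _ Subtype.val_injective
  have h : Module.End.eigenspace (T : H →ₗ[ℝ] H) μ = Submodule.span ℝ (Set.range v) := by
    apply le_antisymm
    · intro x hx
      rw [Module.End.mem_eigenspace_iff, ContinuousLinearMap.coe_coe] at hx
      have h0 : ∀ i, t i ≠ μ → ⟪b i, x⟫_ℝ = 0 := by
        intro i hi
        have h1 := inner_eigenbasis b hT ht i x
        rw [hx, real_inner_smul_right] at h1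
        have h2 : (t i - μ) * ⟪b i, x⟫_ℝ = 0 := by linarith
        exact (mul_eq_zero.1 h2).resolve_left (sub_ne_zero.2 hi)
      have h1 : x = ∑ i, ⟪v i, x⟫_ℝ • v i := by
        refine ext_inner_hilbertBasis b fun j => ?_
        rw [inner_sum]
        simp only [real_inner_smul_right, v, orthonormal_iff_ite.1 b.orthonormal, mul_ite, mul_one,
          mul_zero]
        by_cases hj : t j = μ
        · rw [Finset.sum_eq_single (⟨j, hj⟩ : {i // t i = μ})]
          · simp
          · intro i _ hi
            rw [if_neg]
            rintro rfl
            exact hi rfl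
          · simp
        · rw [h0 j hj, Finset.sum_eq_zero]
          intro i _
          rw [if_neg]
          rintro rfl
          exact hj i.2
      rw [h1]
      exact Submodule.sum_mem _ fun i _ =>
        Submodule.smul_mem _ _ (Submodule.subset_span ⟨i, rfl⟩)
    · rw [Submodule.span_le]
      rintro _ ⟨i, rfl⟩
      rw [SetLike.mem_coe, Module.End.mem_eigenspace_iff, ContinuousLinearMap.coe_coe]
      simp only [v]
      rw [ht, i.2]
  rw [h, finrank_span_eq_card hv, Nat.card_eq_fintype_card]

/-- The sum over an eigenbasis is grouped by eigenvalue, each fibre having the dimension of the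
eigenspace as cardinality, and exponentiated. It converges since `-log (1 - t) ≤ t / (1 - t) ≤ t /
(1 - q)`. -/
theorem log_fredholmDetOneSub {ι : Type*} (b : HilbertBasis ι ℝ H) {T : H →L[ℝ] H}
    {t : ι → ℝ} (hT : IsSelfAdjoint T) (ht : ∀ i, T (b i) = t i • b i) (h0 : ∀ i, 0 ≤ t i)
    {q : ℝ} (hq : q < 1) (htq : ∀ i, t i ≤ q) (hs : Summable t) :
    HasSum (fun i => Real.log (1 - t i)) (Real.log (fredholmDetOneSub T)) := by
  have hlog : Summable fun i => Real.log (1 - t i) := by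
    refine Summable.of_norm_bounded (hs.mul_left (1 - q)⁻¹) fun i => ?_
    have h1 : 0 < 1 - t i := by linarith [htq i]
    have h2 : Real.log (1 - t i) ≤ 0 := Real.log_nonpos h1.le (by linarith [h0 i])
    rw [Real.norm_of_nonpos h2]
    have h3 := Real.one_sub_inv_le_log_of_pos h1
    have h4 : (1 - t i)⁻¹ - 1 = (1 - t i)⁻¹ * t i := by field_simp; ring
    have h5 : (1 - t i)⁻¹ ≤ (1 - q)⁻¹ := inv_anti₀ (by linarith) (by linarith [htq i])
    have h6 := mul_le_mul_of_nonneg_right h5 (h0 i)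
    linarith
  have hfin : ∀ μ : ℝ, μ ≠ 0 → Finite {i // t i = μ} := by
    intro μ hμ
    have h1 := hs.tendsto_cofinite_zero
    have h2 := h1.eventually_ne hμ.symm
    rw [Filter.eventually_cofinite] at h2
    have h3 : {i | t i = μ}.Finite := by simpa using h2
    exact h3.to_subtype
  let e : (Σ μ : ℝ, {i // t i = μ}) ≃ ι := Equiv.sigmaFiberEquiv t
  have h1 : HasSum (fun a : Σ μ : ℝ, {i // t i = μ} => Real.log (1 - a.1))
      (∑' i, Real.log (1 - t i)) := by
    refine ((Equiv.hasSum_iff e).2 hlog.hasSum).congr_fun fun a => ?_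
    simp only [Function.comp, e, Equiv.sigmaFiberEquiv, Equiv.coe_fn_mk, a.2.2]
  have h2 : HasSum (fun μ : ℝ =>
      (Module.finrank ℝ (Module.End.eigenspace (T : H →ₗ[ℝ] H) μ) : ℝ) * Real.log (1 - μ))
      (∑' i, Real.log (1 - t i)) := by
    refine h1.sigma fun μ => ?_
    -- The fibre over zero may be infinite, where `finrank` is not its cardinality, but each term
    -- there is `log 1 = 0`.
    by_cases hμ : μ = 0
    · subst hμ
      simp
    · have := hfin μ hμ
      have := Fintype.ofFinite {i // t i = μ}
      rw [finrank_eigenspace_eq_card b hT ht, Nat.card_eq_fintype_card]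
      have h3 := hasSum_fintype fun _ : {i // t i = μ} => Real.log (1 - μ)
      simpa using h3
  have h3 := h2.rexp
  have h4 : (Real.exp ∘ fun μ : ℝ =>
      (Module.finrank ℝ (Module.End.eigenspace (T : H →ₗ[ℝ] H) μ) : ℝ) * Real.log (1 - μ))
      = fun μ => (1 - μ) ^ Module.finrank ℝ (Module.End.eigenspace (T : H →ₗ[ℝ] H) μ) := by
    funext μ
    simp only [Function.comp]
    by_cases hμ : μ = 0
    · simp [hμ]
    have := hfin μ hμ
    rw [finrank_eigenspace_eq_card b hT ht]
    rcases isEmpty_or_nonempty {i // t i = μ} with h | ⟨⟨i, hi⟩⟩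
    · simp
    · have : 0 < 1 - μ := by rw [← hi]; linarith [htq i]
      rw [Real.exp_nat_mul, Real.exp_log this]
  rw [h4] at h3
  rw [fredholmDetOneSub, h3.tprod_eq, Real.log_exp]
  exact hlog.hasSum

/-- Jensen's inequality for the log-determinant: with respect to any orthonormal basis it is
dominated by the sum of the logarithms of the diagonal entries, in the form of tangent lines. -/
theorem exists_hasSum_log_fredholmDet {ι : Type*} (b : HilbertBasis ι ℝ H) {R : H →L[ℝ] H}
    (hR : HilbertSchmidt R) (hR1 : ‖R‖ < 1) :
    ∃ d : ι → ℝ, HasSum d (Real.log (fredholmDetOneSub (adjoint R ∘L R))) ∧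
      ∀ i, ∀ c : ℝ, 0 < c → d i ≤ Real.log c + (1 - ‖R (b i)‖ ^ 2) / c - 1 := by
  set T := adjoint R ∘L R with hTdef
  have hpos : T.IsPositive := ContinuousLinearMap.isPositive_adjoint_comp_self R
  have hTx : ∀ x y, ⟪x, T y⟫_ℝ = ⟪R x, R y⟫_ℝ := fun x y => by
    rw [hTdef, ContinuousLinearMap.comp_apply, ContinuousLinearMap.adjoint_inner_right]
  obtain ⟨κ, u, t, ht⟩ := exists_eigenbasis hpos.isSelfAdjoint
    (hR.comp_left (adjoint R)).isCompactOperator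
  have htu : ∀ j, t j = ‖R (u j)‖ ^ 2 := by
    intro j
    have := hTx (u j) (u j)
    rw [ht, real_inner_smul_right, real_inner_self_eq_norm_sq, real_inner_self_eq_norm_sq,
      u.orthonormal.1 j] at this
    linarith
  have ht0 : ∀ j, 0 ≤ t j := fun j => by rw [htu]; positivity
  have htq : ∀ j, t j ≤ ‖R‖ ^ 2 := fun j => by
    rw [htu]
    refine pow_le_pow_left₀ (norm_nonneg _) ?_ 2
    have := R.le_opNorm (u j)
    rwa [u.orthonormal.1 j, mul_one] at this
  have hq : ‖R‖ ^ 2 < 1 := by nlinarith [norm_nonneg R]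
  have hts : Summable t := (hR.summable u).congr fun j => (htu j).symm
  have hdet := log_fredholmDetOneSub u hpos.isSelfAdjoint ht ht0 hq htq hts
  -- Summing over `j` gives `-⟪b i, log (1 - T) (b i)⟫`, which is `-d i`; summing over `i` gives
  -- `-log (1 - t j)`. Nonnegativity permits the interchange.
  let w : κ × ι → ℝ := fun p => ⟪b p.2, u p.1⟫_ℝ ^ 2 * -Real.log (1 - t p.1)
  have hl0 : ∀ j, 0 ≤ -Real.log (1 - t j) := fun j =>
    neg_nonneg.2 (Real.log_nonpos (by linarith [htq j]) (by linarith [ht0 j]))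
  have hrow : ∀ j, HasSum (fun i => w (j, i)) (-Real.log (1 - t j)) := by
    intro j
    have := (hasSum_sq_inner b (u j)).mul_right (-Real.log (1 - t j))
    rwa [u.orthonormal.1 j, one_pow, one_mul] at this
  have hw0 : 0 ≤ w := fun p => mul_nonneg (sq_nonneg _) (hl0 _)
  have hw : Summable w := (summable_prod_of_nonneg hw0).2
    ⟨fun j => (hrow j).summable, hdet.summable.neg.congr fun j => (hrow j).tsum_eq.symm⟩
  have htot : ∑' p, w p = -Real.log (fredholmDetOneSub T) :=
    (hw.hasSum.prod_fiberwise hrow).unique hdet.neg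
  have hw' : Summable fun p : ι × κ => w p.swap := hw.prod_symm
  have htot' : ∑' p : ι × κ, w p.swap = ∑' p, w p := (Equiv.prodComm ι κ).tsum_eq w
  have hcol : ∀ i, Summable fun j => w (j, i) := fun i => hw'.prod_factor i
  refine ⟨fun i => -∑' j, w (j, i), ?_, ?_⟩
  · have h1 := (hw'.hasSum.prod_fiberwise fun i => (hcol i).hasSum).neg
    rwa [htot', htot, neg_neg] at h1
  · intro i c hc
    have hsq : HasSum (fun j => ⟪b i, u j⟫_ℝ ^ 2) 1 := by
      have := hasSum_sq_inner u (b i)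
      rw [b.orthonormal.1 i, one_pow] at this
      exact this.congr_fun fun j => by rw [real_inner_comm]
    have hsqt : HasSum (fun j => ⟪b i, u j⟫_ℝ ^ 2 * t j) (‖R (b i)‖ ^ 2) := by
      have := u.hasSum_inner_mul_inner (b i) (T (b i))
      rw [hTx, real_inner_self_eq_norm_sq] at this
      refine this.congr_fun fun j => ?_
      rw [inner_eigenbasis u hpos.isSelfAdjoint ht, real_inner_comm (u j)]
      ring
    have h1 := (hsq.mul_right (Real.log c + 1 / c - 1)).sub (hsqt.mul_right c⁻¹)
    have h2 := hasSum_le (fun j => ?_) (hcol i).hasSum.neg h1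
    · refine h2.trans (le_of_eq ?_)
      field_simp
      ring
    -- The tangent line of `log` at `c`, evaluated at `1 - t j`, weighted by `⟪b i, u j⟫²`; these
    -- weights sum to one over `j`.
    · have h3 : 0 < 1 - t j := by linarith [htq j]
      have h4 := Real.log_le_sub_one_of_pos (div_pos h3 hc)
      rw [Real.log_div h3.ne' hc.ne'] at h4
      have h5 := mul_le_mul_of_nonneg_left h4 (sq_nonneg ⟪b i, u j⟫_ℝ)
      simp only [w]
      rw [div_eq_mul_inv] at h5 ⊢
      linarith

end FredholmDeterminant

/-! ### The maximizer of the entropic profit -/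

section EntropicArgmax

variable {H : Type*} [NormedAddCommGroup H] [InnerProductSpace ℝ H] [CompleteSpace H]

theorem exists_diagonal {ι : Type*} (b : HilbertBasis ι ℝ H) (f : ι → ℝ) {C : ℝ} (hC : 0 ≤ C)
    (hf : ∀ i, |f i| ≤ C) :
    ∃ D : H →L[ℝ] H, (∀ i, D (b i) = f i • b i) ∧ IsSelfAdjoint D ∧ ∀ x, ‖D x‖ ≤ C * ‖x‖ := by
  have hsq : ∀ i, f i ^ 2 ≤ C ^ 2 := fun i => sq_le_sq' (abs_le.1 (hf i)).1 (abs_le.1 (hf i)).2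
  have hmem : ∀ x, Memℓp (fun i => f i * b.repr x i) 2 := by
    intro x
    rw [memℓp_gen_iff (by norm_num)]
    refine Summable.of_nonneg_of_le (fun i => by positivity) (fun i => ?_)
      ((hasSum_sq_inner b x).summable.mul_left (C ^ 2))
    rw [b.repr_apply_apply]
    simp only [ENNReal.toReal_ofNat, Real.rpow_ofNat, norm_mul, Real.norm_eq_abs, mul_pow, sq_abs]
    exact mul_le_mul_of_nonneg_right (hsq i) (sq_nonneg _)
  let D₀ : H →ₗ[ℝ] H :=
    { toFun := fun x => b.repr.symm ⟨fun i => f i * b.repr x i, hmem x⟩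
      map_add' := fun x y => by
        rw [← map_add]
        congr 1
        ext i
        simp [mul_add]
        rfl
      map_smul' := fun c x => by
        rw [RingHom.id_apply, ← map_smul]
        congr 1
        ext i
        simp
        ring }
  have hD₀ : ∀ x i, ⟪b i, D₀ x⟫_ℝ = f i * ⟪b i, x⟫_ℝ := by
    intro x i
    rw [← b.repr_apply_apply, ← b.repr_apply_apply]
    simp [D₀]
  have hbound : ∀ x, ‖D₀ x‖ ≤ C * ‖x‖ := by
    intro x
    refine le_of_sq_le_sq ?_ (by positivity)
    rw [mul_pow]
    refine hasSum_le (fun i => ?_) (hasSum_sq_inner b (D₀ x))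
      ((hasSum_sq_inner b x).mul_left (C ^ 2))
    rw [hD₀, mul_pow]
    exact mul_le_mul_of_nonneg_right (hsq i) (sq_nonneg _)
  refine ⟨D₀.mkContinuous C hbound, fun i => ?_, ?_, hbound⟩
  · refine ext_inner_hilbertBasis b fun j => ?_
    rw [LinearMap.mkContinuous_apply, hD₀, real_inner_smul_right]
    by_cases hij : j = i
    · rw [hij]
    · rw [b.orthonormal.2 hij]
      simp
  · rw [ContinuousLinearMap.isSelfAdjoint_iff_isSymmetric]
    intro x y
    refine (b.hasSum_inner_mul_inner _ _).unique
      ((b.hasSum_inner_mul_inner _ _).congr_fun fun i => ?_)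
    change ⟪D₀ x, b i⟫_ℝ * ⟪b i, y⟫_ℝ = ⟪x, b i⟫_ℝ * ⟪b i, D₀ y⟫_ℝ
    rw [hD₀, real_inner_comm, hD₀, real_inner_comm x]
    ring

/-- The last identity is the stationarity condition of `r ↦ 2 x r + ε log (1 - r²)`. The uniform
bound keeps the operator norm of the maximizer below one; the linear bound makes it Hilbert-Schmidt,
as the eigenvalues of `G* M` are summable. -/
theorem shrinkage_spec {ε x c : ℝ} (hε : 0 < ε) (hx : 0 ≤ x) (hxc : x ≤ c) :
    0 ≤ shrinkage ε x ∧ shrinkage ε x ≤ 1 - ε / (Real.sqrt (4 * c ^ 2 + ε ^ 2) + ε) ∧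
      shrinkage ε x ≤ ε⁻¹ * x ∧ x * (1 - shrinkage ε x ^ 2) = ε * shrinkage ε x := by
  have hs0 := Real.sqrt_nonneg (4 * x ^ 2 + ε ^ 2)
  have hs2 := Real.sq_sqrt (show 0 ≤ 4 * x ^ 2 + ε ^ 2 by positivity)
  have hsc : Real.sqrt (4 * x ^ 2 + ε ^ 2) ≤ Real.sqrt (4 * c ^ 2 + ε ^ 2) :=
    Real.sqrt_le_sqrt (by nlinarith)
  have hse : ε ≤ Real.sqrt (4 * x ^ 2 + ε ^ 2) := Real.le_sqrt_of_sq_le (by nlinarith)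
  have hsx : 2 * x ≤ Real.sqrt (4 * x ^ 2 + ε ^ 2) := Real.le_sqrt_of_sq_le (by nlinarith)
  unfold shrinkage
  generalize Real.sqrt (4 * x ^ 2 + ε ^ 2) = s at *
  have hpos : 0 < s + ε := by linarith
  refine ⟨by positivity, ?_, ?_, ?_⟩
  · have h1 : ε / (Real.sqrt (4 * c ^ 2 + ε ^ 2) + ε) ≤ ε / (s + ε) :=
      div_le_div_of_nonneg_left hε.le hpos (by linarith)
    have h2 : 2 * x / (s + ε) ≤ 1 - ε / (s + ε) := by
      rw [div_le_iff₀ hpos, sub_mul, div_mul_cancel₀ _ hpos.ne']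
      linarith
    linarith
  · rw [div_le_iff₀ hpos, mul_assoc, inv_mul_eq_div, le_div_iff₀ hε]
    nlinarith
  · field_simp
    linear_combination x * hs2

theorem exists_entropicArgmax {G M : H →L[ℝ] H} (hG : HilbertSchmidt G) (hM : HilbertSchmidt M)
    (hP : (adjoint G ∘L M).IsPositive) {ε : ℝ} (hε : 0 < ε) :
    ∃ R : H →L[ℝ] H, IsEntropicArgmax ε G M R ∧
      IsFunctionOf (shrinkage ε) (adjoint G ∘L M) R ∧ IsSelfAdjoint R ∧ ∀ x, ‖R x‖ ≤ ‖x‖ := by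
  set P := adjoint G ∘L M with hPdef
  have hPsa := hP.isSelfAdjoint
  have hPMG : adjoint M ∘L G = P := by
    rw [← hPsa.adjoint_eq, hPdef, ContinuousLinearMap.adjoint_comp,
      ContinuousLinearMap.adjoint_adjoint]
  obtain ⟨ι, e, p, hp⟩ := exists_eigenbasis hPsa (hM.comp_left (adjoint G)).isCompactOperator
  have hep : ∀ i, ⟪e i, P (e i)⟫_ℝ = p i := fun i => by
    rw [hp, real_inner_smul_right, real_inner_self_eq_norm_sq, e.orthonormal.1 i]
    ring
  have hp0 : ∀ i, 0 ≤ p i := fun i => by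
    rw [← hep, real_inner_comm]
    exact hP.inner_nonneg_left _
  have hpc : ∀ i, p i ≤ ‖P‖ := fun i => by
    have h1 := P.le_opNorm (e i)
    rw [hp, norm_smul, e.orthonormal.1 i, mul_one, mul_one, Real.norm_of_nonneg (hp0 i)] at h1
    exact h1
  have hps : Summable p := by
    refine (hasSum_hsInner e hG hM).summable.congr fun i => ?_
    rw [← hep, hPdef, ContinuousLinearMap.comp_apply, ContinuousLinearMap.adjoint_inner_right]
  set f : ι → ℝ := fun i => shrinkage ε (p i) with hfdef
  have hf := fun i => shrinkage_spec hε (hp0 i) (hpc i)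
  set q : ℝ := 1 - ε / (Real.sqrt (4 * ‖P‖ ^ 2 + ε ^ 2) + ε) with hqdef
  have hpos : 0 < Real.sqrt (4 * ‖P‖ ^ 2 + ε ^ 2) + ε := by positivity
  have hq1 : q < 1 := by
    have := div_pos hε hpos
    linarith
  have hq0 : 0 ≤ q := by
    rw [hqdef, sub_nonneg, div_le_one hpos]
    linarith [Real.sqrt_nonneg (4 * ‖P‖ ^ 2 + ε ^ 2)]
  have hf0 : ∀ i, 0 ≤ f i := fun i => (hf i).1
  have hfq : ∀ i, f i ≤ q := fun i => (hf i).2.1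
  have hf1 : ∀ i, f i < 1 := fun i => (hfq i).trans_lt hq1
  have hf2q : ∀ i, f i ^ 2 ≤ q ^ 2 := fun i => pow_le_pow_left₀ (hf0 i) (hfq i) 2
  have hfs : Summable fun i => f i ^ 2 :=
    Summable.of_nonneg_of_le (fun i => sq_nonneg _)
      (fun i => by nlinarith [(hf i).2.2.1, hf0 i, hf1 i]) (hps.mul_left ε⁻¹)
  obtain ⟨R, hRe, hRsa, hRn⟩ := exists_diagonal e f hq0 fun i =>
    by rw [abs_of_nonneg (hf0 i)]; exact hfq i
  have hRnorm : ‖R‖ < 1 := (R.opNorm_le_bound hq0 hRn).trans_lt hq1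
  have hRHS : HilbertSchmidt R := HilbertSchmidt.of_summable e <| hfs.congr fun i => by
    rw [hRe, norm_smul, e.orthonormal.1 i, mul_one, Real.norm_eq_abs, sq_abs]
  have hfun : IsFunctionOf (shrinkage ε) P R := by
    intro x v hv
    refine ext_inner_hilbertBasis e fun i => ?_
    rw [inner_eigenbasis e hRsa hRe, real_inner_smul_right]
    have h1 := inner_eigenbasis e hPsa hp i v
    rw [hv, real_inner_smul_right] at h1
    by_cases h : ⟪e i, v⟫_ℝ = 0
    · simp [h]
    · rw [mul_right_cancel₀ h h1]
  -- As `P = G* M = M* G`, both `N(M)` and `N(G)` lie in `N(P)`; with `R` self-adjoint this yields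
  -- both range and kernel constraints.
  have hker : ∀ z, P z = 0 → R z = 0 := by
    intro z hz
    have := hfun 0 z (by rw [hz, zero_smul])
    rw [this]
    simp [shrinkage]
  have hadm : R ∈ admissible G M := by
    refine ⟨hRHS.isHilbertSchmidt, ?_, ?_, hRnorm⟩
    · intro x hx
      refine hker x ?_
      have h1 : M x = 0 := hx
      rw [hPdef, ContinuousLinearMap.comp_apply, h1, map_zero]
    · rintro _ ⟨x, rfl⟩
      rw [Submodule.mem_orthogonal]
      intro z hz
      have h1 : G z = 0 := hz
      have h2 : R z = 0 := hker z (by rw [← hPMG, ContinuousLinearMap.comp_apply, h1, map_zero])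
      rw [ContinuousLinearMap.coe_coe, ← ContinuousLinearMap.adjoint_inner_left, hRsa.adjoint_eq,
        h2, inner_zero_left]
  have htr : ∀ S : H →L[ℝ] H, HasSum (fun i => p i * ⟪e i, S (e i)⟫_ℝ)
      (trace (S ∘L (adjoint M ∘L G))) := by
    intro S
    have h1 : S ∘L (adjoint M ∘L G) = adjoint (M ∘L adjoint S) ∘L G := by
      rw [ContinuousLinearMap.adjoint_comp, ContinuousLinearMap.adjoint_adjoint,
        ContinuousLinearMap.comp_assoc]
    rw [h1, trace_adjoint_comp]
    refine (hasSum_hsInner e (hM.comp_right (adjoint S)) hG).congr_fun fun i => ?_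
    rw [← ContinuousLinearMap.adjoint_inner_right, ← ContinuousLinearMap.comp_apply, ← h1, hPMG,
      ContinuousLinearMap.comp_apply, hp, map_smul, real_inner_smul_right]
  have hprofit : HasSum (fun i => 2 * (p i * f i) + ε * Real.log (1 - f i ^ 2))
      (entropicProfit ε G M R) := by
    refine HasSum.add (HasSum.mul_left 2 ?_) (HasSum.mul_left ε ?_)
    · refine (htr R).congr_fun fun i => ?_
      rw [hRe, real_inner_smul_right, real_inner_self_eq_norm_sq, e.orthonormal.1 i]
      ring
    · refine log_fredholmDetOneSub e
        (ContinuousLinearMap.isPositive_adjoint_comp_self R).isSelfAdjoint (fun i => ?_) (fun i => sq_nonneg _) (q := q ^ 2) (by nlinarith) hf2q hfs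
      rw [ContinuousLinearMap.comp_apply, hRsa.adjoint_eq, hRe, map_smul, hRe, smul_smul, sq]
  refine ⟨R, ⟨hadm, fun R' hR' hne => ?_⟩, hfun, hRsa, fun x => ?_⟩
  · obtain ⟨hR'HS, -, -, hR'1⟩ := hR'
    have hR'HS : HilbertSchmidt R' := hR'HS _ (someBasis H)
    obtain ⟨d, hd, hdle⟩ := exists_hasSum_log_fredholmDet e hR'HS hR'1
    have hprofit' : HasSum (fun i => 2 * (p i * ⟪e i, R' (e i)⟫_ℝ) + ε * d i)
        (entropicProfit ε G M R') := ((htr R').mul_left 2).add (hd.mul_left ε)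
    have hc : ∀ i, 0 < 1 - f i ^ 2 := fun i => by nlinarith [hf0 i, hf1 i]
    -- Tangent line at `c = 1 - f i ^ 2`. Substituting `p i = ε f i / (1 - f i ^ 2)` completes the
    -- square, leaving a gap that is strict for some `i` unless `R' = R`.
    have hterm : ∀ i, 2 * (p i * ⟪e i, R' (e i)⟫_ℝ) + ε * d i
        ≤ 2 * (p i * f i) + ε * Real.log (1 - f i ^ 2)
          - ε / (1 - f i ^ 2) * ‖R' (e i) - R (e i)‖ ^ 2 := by
      intro i
      have h1 := mul_le_mul_of_nonneg_left (hdle i _ (hc i)) hε.le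
      have h2 : ‖R' (e i) - R (e i)‖ ^ 2
          = ‖R' (e i)‖ ^ 2 - 2 * f i * ⟪e i, R' (e i)⟫_ℝ + f i ^ 2 := by
        rw [norm_sub_sq_real, hRe, real_inner_smul_right, norm_smul, e.orthonormal.1 i,
          real_inner_comm, mul_one, Real.norm_eq_abs, sq_abs]
        ring
      have h3 : p i = ε * f i / (1 - f i ^ 2) := by
        rw [eq_div_iff (hc i).ne']
        exact (hf i).2.2.2
      rw [h2]
      refine (add_le_add_right h1 _).trans (le_of_eq ?_)
      rw [h3]
      have h4 := (hc i).ne'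
      field_simp
      ring
    obtain ⟨i, hi⟩ : ∃ i, R' (e i) ≠ R (e i) := by
      by_contra! h
      exact hne (ext_hilbertBasis e h)
    have hgap : ∀ i, 0 ≤ ε / (1 - f i ^ 2) * ‖R' (e i) - R (e i)‖ ^ 2 := fun i =>
      mul_nonneg (div_pos hε (hc i)).le (sq_nonneg _)
    refine hasSum_lt (fun i => (hterm i).trans (sub_le_self _ (hgap i))) (i := i) ?_ hprofit'
      hprofit
    refine (hterm i).trans_lt (sub_lt_self _ (mul_pos (div_pos hε (hc i)) ?_))
    exact pow_pos (norm_pos_iff.2 (sub_ne_zero.2 hi)) 2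
  · exact (hRn x).trans (mul_le_of_le_one_left (norm_nonneg _) hq1.le)

end EntropicArgmax

/-! ### Gaussian vectors as random series -/

section WhiteNoise

/-- The law of a family of independent standard normal variables indexed by `ι`. -/
def noiseMeasure (ι : Type*) : Measure (ι → ℝ) := Measure.infinitePi fun _ => gaussianReal 0 1

instance (ι : Type*) : IsProbabilityMeasure (noiseMeasure ι) := by
  unfold noiseMeasure
  infer_instance

variable {ι : Type*}

theorem measurePreserving_noise (i : ι) :
    MeasurePreserving (fun ω : ι → ℝ => ω i) (noiseMeasure ι) (gaussianReal 0 1) :=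
  measurePreserving_eval_infinitePi _ i

theorem memLp_noise (i : ι) : MemLp (fun ω : ι → ℝ => ω i) 2 (noiseMeasure ι) :=
  (memLp_id_gaussianReal 2).comp_measurePreserving (measurePreserving_noise i)

theorem iIndepFun_noise : iIndepFun (fun (i : ι) (ω : ι → ℝ) => ω i) (noiseMeasure ι) :=
  iIndepFun_infinitePi (X := fun _ => id) fun _ => measurable_id

theorem integral_noise_mul [DecidableEq ι] (i j : ι) :
    ∫ ω, ω i * ω j ∂noiseMeasure ι = if i = j then 1 else 0 := by
  have h0 : ∀ i, ∫ ω : ι → ℝ, ω i ∂noiseMeasure ι = 0 := fun i => by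
    have := integral_map (μ := noiseMeasure ι) (measurePreserving_noise i).measurable.aemeasurable
      (f := id) (by fun_prop)
    rw [(measurePreserving_noise i).map_eq] at this
    simpa using this.symm
  split_ifs with h
  · subst h
    have := integral_map (μ := noiseMeasure ι) (measurePreserving_noise i).measurable.aemeasurable
      (f := fun x : ℝ => x * x) (by fun_prop)
    rw [(measurePreserving_noise i).map_eq] at this
    rw [← this]
    have h1 := variance_id_gaussianReal (μ := 0) (v := 1)
    rw [variance_eq_integral (by fun_prop)] at h1
    simpa [sq] using h1
  · have h1 := (iIndepFun_noise.indepFun h).integral_fun_mul_eq_mul_integral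
      (measurePreserving_noise i).measurable.aestronglyMeasurable
      (measurePreserving_noise j).measurable.aestronglyMeasurable
    rw [h1, h0, zero_mul]

variable {E : Type*} [NormedAddCommGroup E] [InnerProductSpace ℝ E] [CompleteSpace E]

theorem memLp_noise_smul (i : ι) (x : E) :
    MemLp (fun ω : ι → ℝ => ω i • x) 2 (noiseMeasure ι) := by
  have := (ContinuousLinearMap.toSpanSingleton ℝ x).comp_memLp' (memLp_noise i)
  simpa [Function.comp_def] using this

theorem inner_noise_smul [DecidableEq ι] (i j : ι) (x y : E) :
    ⟪(memLp_noise_smul i x).toLp, (memLp_noise_smul j y).toLp⟫_ℝ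
      = if i = j then ⟪x, y⟫_ℝ else 0 := by
  rw [L2.inner_def]
  have : ∫ ω, ⟪(memLp_noise_smul i x).toLp _ ω, (memLp_noise_smul j y).toLp _ ω⟫_ℝ ∂noiseMeasure ι
      = ∫ ω, (ω i * ω j) * ⟪x, y⟫_ℝ ∂noiseMeasure ι := by
    refine integral_congr_ae ?_
    filter_upwards [(memLp_noise_smul i x).coeFn_toLp, (memLp_noise_smul j y).coeFn_toLp]
      with ω h1 h2
    rw [h1, h2, real_inner_smul_left, real_inner_smul_right, mul_assoc]
  rw [this, integral_mul_const, integral_noise_mul]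
  split_ifs <;> simp

/-- The embedding `x ↦ ξ i • x` for the `i`-th standard normal variable `ξ i`. -/
def noiseEmbedding (E : Type*) [NormedAddCommGroup E] [InnerProductSpace ℝ E] [CompleteSpace E]
    (i : ι) : E →ₗᵢ[ℝ] Lp E 2 (noiseMeasure ι) where
  toFun x := (memLp_noise_smul i x).toLp
  map_add' x y := by
    rw [← MemLp.toLp_add]
    exact MemLp.toLp_congr _ _ (Filter.Eventually.of_forall fun ω => by simp)
  map_smul' c x := by
    rw [RingHom.id_apply, ← MemLp.toLp_const_smul]
    exact MemLp.toLp_congr _ _ (Filter.Eventually.of_forall fun ω => smul_comm (ω i) c x)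
  norm_map' x := by
    classical
    have h := inner_noise_smul (ι := ι) i i x x
    rw [if_pos rfl, real_inner_self_eq_norm_sq, real_inner_self_eq_norm_sq] at h
    exact (pow_left_inj₀ (norm_nonneg _) (norm_nonneg _) two_ne_zero).1 h

theorem orthogonalFamily_noiseEmbedding :
    OrthogonalFamily ℝ (fun _ : ι => E) (noiseEmbedding E) := by
  classical
  intro i j hij x y
  have h := inner_noise_smul i j x y
  rwa [if_neg hij] at h

/-- The random series `∑ ξ i • v i` for square summable `v`. -/
def noiseSeries (v : lp (fun _ : ι => E) 2) : Lp E 2 (noiseMeasure ι) :=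
  orthogonalFamily_noiseEmbedding.linearIsometry v

theorem inner_noiseSeries (v w : lp (fun _ : ι => E) 2) :
    ⟪noiseSeries v, noiseSeries w⟫_ℝ = ⟪v, w⟫_ℝ :=
  LinearIsometry.inner_map_map _ v w

theorem hasSum_noiseSeries (v : lp (fun _ : ι => E) 2) :
    HasSum (fun i => noiseEmbedding E i (v i)) (noiseSeries v) :=
  orthogonalFamily_noiseEmbedding.hasSum_linearIsometry v

theorem norm_exp_ofReal_mul_I_sub_le (x y : ℝ) :
    ‖Complex.exp (x * Complex.I) - Complex.exp (y * Complex.I)‖ ≤ |x - y| := by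
  have h1 : Complex.exp (x * Complex.I) - Complex.exp (y * Complex.I)
      = Complex.exp (y * Complex.I) * (Complex.exp (Complex.I * ((x - y : ℝ) : ℂ)) - 1) := by
    rw [mul_sub, ← Complex.exp_add, mul_one]
    congr 2
    push_cast
    ring
  rw [h1, norm_mul, Complex.norm_exp_ofReal_mul_I, one_mul]
  exact Real.norm_exp_I_mul_ofReal_sub_one_le

/-- The map is `|t|`-Lipschitz, because `x ↦ exp (i t x)` is and the `L¹` norm is at most the `L²`
norm on a probability space. It carries characteristic functions through `L²` limits. -/
theorem continuous_integral_exp {Ω : Type*} [MeasurableSpace Ω] {P : Measure Ω}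
    [IsProbabilityMeasure P] (t : ℝ) :
    Continuous fun f : Lp ℝ 2 P => ∫ ω, Complex.exp (t * f ω * Complex.I) ∂P := by
  have hint : ∀ f : Lp ℝ 2 P, Integrable (fun ω => Complex.exp (t * f ω * Complex.I)) P := by
    intro f
    refine Integrable.of_bound (C := 1) ?_ (Filter.Eventually.of_forall fun ω => ?_)
    · have := Lp.aestronglyMeasurable f
      exact Complex.continuous_exp.comp_aestronglyMeasurable
        (((Complex.continuous_ofReal.comp_aestronglyMeasurable this).const_mul _).mul_const _)
    · rw [← Complex.ofReal_mul, Complex.norm_exp_ofReal_mul_I]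
  have hlip : LipschitzWith (Real.toNNReal |t|)
      fun f : Lp ℝ 2 P => ∫ ω, Complex.exp (t * f ω * Complex.I) ∂P := by
    refine LipschitzWith.of_dist_le_mul fun f g => ?_
    rw [Real.coe_toNNReal _ (abs_nonneg t), dist_eq_norm, ← integral_sub (hint f) (hint g),
      dist_eq_norm]
    have hfg : MemLp (f - g : Lp ℝ 2 P) 2 P := Lp.memLp _
    have h1 : ∫ ω, ‖(f - g : Lp ℝ 2 P) ω‖ ∂P ≤ ‖f - g‖ := by
      have h2 := eLpNorm_le_eLpNorm_of_exponent_le (p := 1) (q := 2) (by norm_num)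
        hfg.aestronglyMeasurable
      rw [Lp.norm_def, integral_norm_eq_lintegral_enorm hfg.aestronglyMeasurable,
        ← eLpNorm_one_eq_lintegral_enorm]
      exact ENNReal.toReal_mono hfg.eLpNorm_lt_top.ne h2
    refine (norm_integral_le_integral_norm _).trans ?_
    refine le_trans ?_ (mul_le_mul_of_nonneg_left h1 (abs_nonneg t))
    rw [← integral_const_mul]
    refine integral_mono_ae ((hint f).sub (hint g)).norm
      ((hfg.integrable (by norm_num)).norm.const_mul _) ?_
    filter_upwards [Lp.coeFn_sub f g] with ω hω
    rw [hω, Pi.sub_apply, Real.norm_eq_abs, ← abs_mul, mul_sub, ← Complex.ofReal_mul,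
      ← Complex.ofReal_mul]
    exact norm_exp_ofReal_mul_I_sub_le _ _
  exact hlip.continuous

/-- Independence gives the characteristic functions of the finite partial sums, which converge
because the series converges in `L²`. -/
theorem map_noiseSeries_real (c : lp (fun _ : ι => ℝ) 2) :
    (noiseMeasure ι).map (noiseSeries c) = gaussianReal 0 (Real.toNNReal (‖c‖ ^ 2)) := by
  have hm : ∀ f : Lp ℝ 2 (noiseMeasure ι), AEMeasurable f (noiseMeasure ι) := fun f =>
    (Lp.aestronglyMeasurable f).aemeasurable
  have := Measure.isProbabilityMeasure_map (hm (noiseSeries c))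
  refine Measure.ext_of_charFun (funext fun t => ?_)
  have hchar : ∀ f : Lp ℝ 2 (noiseMeasure ι), charFun ((noiseMeasure ι).map f) t
      = ∫ ω, Complex.exp (t * f ω * Complex.I) ∂noiseMeasure ι := by
    intro f
    rw [charFun_apply_real, integral_map (hm f) (by fun_prop)]
  have hterm : ∀ i, charFun ((noiseMeasure ι).map fun ω => ω i * c i) t
      = Complex.exp (-((c i ^ 2 : ℝ) * t ^ 2 / 2)) := by
    intro i
    have h1 : (noiseMeasure ι).map (fun ω => ω i * c i)
        = (gaussianReal 0 1).map fun x => x * c i := by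
      rw [← (measurePreserving_noise i).map_eq, Measure.map_map (by fun_prop) (by fun_prop)]
      rfl
    rw [h1, gaussianReal_map_mul_const, charFun_gaussianReal]
    congr 1
    simp
  have hfin : ∀ s : Finset ι, charFun ((noiseMeasure ι).map
      (∑ i ∈ s, noiseEmbedding ℝ i (c i) : Lp ℝ 2 (noiseMeasure ι))) t
      = Complex.exp (-((∑ i ∈ s, c i ^ 2 : ℝ) * t ^ 2 / 2)) := by
    intro s
    have h1 : (∑ i ∈ s, noiseEmbedding ℝ i (c i) : Lp ℝ 2 (noiseMeasure ι))
        =ᵐ[noiseMeasure ι] fun ω => ∑ i ∈ s, ω i * c i := by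
      classical
      induction s using Finset.induction_on with
      | empty =>
        simp only [Finset.sum_empty]
        exact Lp.coeFn_zero ..
      | insert i s hi ih =>
        simp only [Finset.sum_insert hi]
        refine (Lp.coeFn_add _ _).trans ?_
        filter_upwards [ih, (memLp_noise_smul i (c i)).coeFn_toLp] with ω h1 h2
        rw [Pi.add_apply, h1]
        congr 1
    have hind : iIndepFun (fun i (ω : ι → ℝ) => ω i * c i) (noiseMeasure ι) :=
      iIndepFun_noise.comp (fun i x => x * c i) fun i => by fun_prop
    rw [Measure.map_congr h1, iIndepFun.charFun_map_fun_finsetSum_eq_prod (E := ℝ)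
      (X := fun i (ω : ι → ℝ) => ω i * c i)
      (fun i _ => ((measurePreserving_noise i).measurable.mul_const (c i)).aemeasurable)
      (hind.restrict _),
      Finset.prod_apply, Finset.prod_congr rfl fun i _ => hterm i, ← Complex.exp_sum]
    congr 1
    push_cast
    rw [Finset.sum_neg_distrib, Finset.sum_mul, Finset.sum_div]
  have hlim1 : Filter.Tendsto (fun s : Finset ι => charFun ((noiseMeasure ι).map
      (∑ i ∈ s, noiseEmbedding ℝ i (c i) : Lp ℝ 2 (noiseMeasure ι))) t) Filter.atTop
      (nhds (charFun ((noiseMeasure ι).map (noiseSeries c)) t)) := by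
    simp only [hchar]
    exact (continuous_integral_exp t).continuousAt.tendsto.comp (hasSum_noiseSeries c)
  have hsq : HasSum (fun i => c i ^ 2) (‖c‖ ^ 2) := by
    have := lp.hasSum_inner (𝕜 := ℝ) c c
    rw [real_inner_self_eq_norm_sq] at this
    exact this.congr_fun fun i => by rw [real_inner_self_eq_norm_sq, Real.norm_eq_abs, sq_abs]
  have hlim2 : Filter.Tendsto (fun s : Finset ι => Complex.exp
      (-((∑ i ∈ s, c i ^ 2 : ℝ) * t ^ 2 / 2))) Filter.atTop
      (nhds (Complex.exp (-((‖c‖ ^ 2 : ℝ) * t ^ 2 / 2)))) := by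
    have hcont : Continuous fun r : ℝ => Complex.exp (-(r * t ^ 2 / 2)) := by fun_prop
    exact hcont.continuousAt.tendsto.comp hsq
  simp only [hfin] at hlim1
  rw [tendsto_nhds_unique hlim1 hlim2, charFun_gaussianReal]
  congr 1
  rw [Real.coe_toNNReal _ (sq_nonneg _)]
  simp

/-- The coefficients of the image of a random series under a continuous linear map. -/
def lpMap {F : Type*} [NormedAddCommGroup F] [InnerProductSpace ℝ F] [CompleteSpace F]
    (L : E →L[ℝ] F) (v : lp (fun _ : ι => E) 2) : lp (fun _ : ι => F) 2 :=
  ⟨fun i => L (v i), by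
    refine (memℓp_gen_iff (by norm_num)).2 ?_
    have h := (lp.memℓp v).summable (by norm_num)
    simp only [ENNReal.toReal_ofNat, Real.rpow_ofNat] at h ⊢
    refine Summable.of_nonneg_of_le (fun i => by positivity) (fun i => ?_)
      (h.mul_left (‖L‖ ^ 2))
    rw [← mul_pow]
    exact pow_le_pow_left₀ (norm_nonneg _) (L.le_opNorm _) 2⟩

theorem map_noiseSeries_ae {F : Type*} [NormedAddCommGroup F] [InnerProductSpace ℝ F]
    [CompleteSpace F] (L : E →L[ℝ] F) (v : lp (fun _ : ι => E) 2) :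
    (fun ω => L (noiseSeries v ω)) =ᵐ[noiseMeasure ι] noiseSeries (lpMap L v) := by
  have h1 : L.compLpL 2 (noiseMeasure ι) (noiseSeries v) = noiseSeries (lpMap L v) := by
    refine ((hasSum_noiseSeries v).mapL (L.compLpL 2 (noiseMeasure ι))).unique ?_
    refine (hasSum_noiseSeries (lpMap L v)).congr_fun fun i => ?_
    refine Lp.ext ?_
    refine (L.coeFn_compLpL _).trans ?_
    filter_upwards [(memLp_noise_smul i (v i)).coeFn_toLp,
      (memLp_noise_smul i (L (v i))).coeFn_toLp] with ω h2 h3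
    refine (congrArg L h2).trans ?_
    rw [map_smul]
    exact h3.symm
  rw [← h1]
  exact (L.coeFn_compLpL _).symm

theorem integral_noiseSeries_mul (v : lp (fun _ : ι => E) 2) (a b : E) :
    ∫ ω, ⟪a, noiseSeries v ω⟫_ℝ * ⟪b, noiseSeries v ω⟫_ℝ ∂noiseMeasure ι
      = ∑' i, ⟪a, v i⟫_ℝ * ⟪b, v i⟫_ℝ := by
  have h := inner_noiseSeries (lpMap (innerSL ℝ b) v) (lpMap (innerSL ℝ a) v)
  rw [L2.inner_def, lp.inner_eq_tsum] at h
  refine (integral_congr_ae ?_).trans h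
  filter_upwards [map_noiseSeries_ae (innerSL ℝ a) v, map_noiseSeries_ae (innerSL ℝ b) v]
    with ω h1 h2
  rw [← h1, ← h2]
  rfl

variable [SecondCountableTopology E] [MeasurableSpace E] [BorelSpace E]

/-- A continuous functional of the series is again a real series, hence normal with mean zero. The
covariance comes from the isometry between coefficients and `L²`. -/
theorem isCenteredGaussian_noiseSeries (v : lp (fun _ : ι => E) 2) {S : E →L[ℝ] E}
    (hS : ∀ a b, ⟪S a, b⟫_ℝ = ∑' i, ⟪a, v i⟫_ℝ * ⟪b, v i⟫_ℝ) :
    IsCenteredGaussian ((noiseMeasure ι).map (noiseSeries v)) S := by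
  have hm : AEMeasurable (noiseSeries v) (noiseMeasure ι) :=
    (Lp.aestronglyMeasurable _).aemeasurable
  have hmap : ∀ L : E →L[ℝ] ℝ, ((noiseMeasure ι).map (noiseSeries v)).map L
      = gaussianReal 0 (Real.toNNReal (‖lpMap L v‖ ^ 2)) := by
    intro L
    rw [AEMeasurable.map_map_of_aemeasurable (by fun_prop) hm, ← map_noiseSeries_real]
    exact Measure.map_congr (map_noiseSeries_ae L v)
  have hprob := Measure.isProbabilityMeasure_map hm
  have hG : IsGaussian ((noiseMeasure ι).map (noiseSeries v)) :=
    isGaussian_of_map_eq_gaussianReal fun L => ⟨0, _, hmap L⟩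
  refine ⟨hG, ?_, ?_⟩
  · have hint : Integrable (fun x : E => x) ((noiseMeasure ι).map (noiseSeries v)) :=
      IsGaussian.integrable_id
    refine ext_inner_left ℝ fun a => ?_
    rw [inner_zero_right, ← integral_inner hint]
    have h1 := integral_map (μ := (noiseMeasure ι).map (noiseSeries v)) (φ := innerSL ℝ a)
      (by fun_prop) (f := id) (by fun_prop)
    rw [hmap] at h1
    simpa using h1.symm
  · have hL2 : MemLp id 2 ((noiseMeasure ι).map (noiseSeries v)) := IsGaussian.memLp_two_id
    refine ContinuousLinearMap.ext fun a => ext_inner_right ℝ fun b => ?_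
    rw [covarianceOperator_inner hL2, hS, ← integral_noiseSeries_mul, integral_map hm]
    exact (Continuous.aestronglyMeasurable (by fun_prop))

end WhiteNoise

/-! ### Bilinearity of the Hilbert-Schmidt inner product; countable bases -/

section HilbertSchmidtInner

variable {E F : Type*} [NormedAddCommGroup E] [InnerProductSpace ℝ E] [CompleteSpace E]
  [NormedAddCommGroup F] [InnerProductSpace ℝ F] [CompleteSpace F]

theorem hsInner_add_right {S T T' : E →L[ℝ] F} (hS : HilbertSchmidt S) (hT : HilbertSchmidt T)
    (hT' : HilbertSchmidt T') : hsInner S (T + T') = hsInner S T + hsInner S T' :=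
  ((((hasSum_hsInner (someBasis E) hS hT).add (hasSum_hsInner (someBasis E) hS hT')).congr_fun
    fun i => by rw [_root_.add_apply, inner_add_right]).tsum_eq)

theorem HilbertSchmidt.neg {T : E →L[ℝ] F} (hT : HilbertSchmidt T) : HilbertSchmidt (-T) :=
  hT.of_norm_le 1 fun x => by simp

theorem hsInner_sub_self {S T : E →L[ℝ] F} (hS : HilbertSchmidt S) (hT : HilbertSchmidt T) :
    hsInner (S - T) (S - T) = hsInner S S + hsInner T T - 2 * hsInner S T :=
  (((((hasSum_hsInner (someBasis E) hS hS).add (hasSum_hsInner (someBasis E) hT hT)).sub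
    ((hasSum_hsInner (someBasis E) hS hT).mul_left 2)).congr_fun fun i => by
      rw [_root_.sub_apply, real_inner_sub_sub_self]
      ring).tsum_eq)

theorem hsInner_self_congr {G : Type*} [NormedAddCommGroup G] [InnerProductSpace ℝ G]
    [CompleteSpace G] {S : E →L[ℝ] F} {T : E →L[ℝ] G} (h : ∀ x, ‖S x‖ = ‖T x‖) :
    hsInner S S = hsInner T T :=
  tsum_congr fun i => by rw [real_inner_self_eq_norm_sq, real_inner_self_eq_norm_sq, h]

/-- Basis vectors are `√2` apart, so the balls of radius `1/2` around them are disjoint.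
Countability allows exchanging the basis sum with the integral of the cost. -/
theorem countable_hilbertBasis [SecondCountableTopology E] {ι : Type*} (b : HilbertBasis ι ℝ E) :
    Countable ι := by
  refine Pairwise.countable_of_isOpen_disjoint (s := fun i => Metric.ball (b i) (1 / 2)) ?_
    (fun i => Metric.isOpen_ball) fun i => ⟨b i, Metric.mem_ball_self (by norm_num)⟩
  intro i j hij
  refine Metric.ball_disjoint_ball ?_
  rw [dist_eq_norm]
  have h : ‖b i - b j‖ ^ 2 = 2 := by
    rw [norm_sub_sq_real, b.orthonormal.1 i, b.orthonormal.1 j, b.orthonormal.2 hij]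
    norm_num
  nlinarith [norm_nonneg (b i - b j)]

end HilbertSchmidtInner

/-! ### The Wasserstein distance between centered Gaussian measures -/

section Wasserstein

variable {E H : Type*} [NormedAddCommGroup E] [InnerProductSpace ℝ E] [CompleteSpace E]
  [NormedAddCommGroup H] [InnerProductSpace ℝ H] [CompleteSpace H]

/-- The polar decomposition of `S^{1/2} V`, through the square root of `V* S V`. -/
theorem exists_polar {S : E →L[ℝ] E} (hS : S.IsPositive) (V : H →L[ℝ] E) :
    (adjoint V ∘L S ∘L V).IsPositive ∧ (∀ x, ‖opSqrt (adjoint V ∘L S ∘L V) x‖ = ‖opSqrt S (V x)‖) ∧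
    ∃ U : H →L[ℝ] E, adjoint U ∘L U ∘L adjoint U = adjoint U ∧
      opSqrt (adjoint V ∘L S ∘L V) = adjoint (opSqrt S ∘L U) ∘L V := by
  set N := opSqrt S with hN
  have hNa : adjoint N = N := adjoint_opSqrt hS
  have hQ : adjoint V ∘L S ∘L V = adjoint (N ∘L V) ∘L (N ∘L V) := by
    rw [ContinuousLinearMap.adjoint_comp, hNa]
    ext x
    simp [hN, opSqrt_apply_apply hS]
  have hpos : (adjoint V ∘L S ∘L V).IsPositive := by
    rw [hQ]
    exact ContinuousLinearMap.isPositive_adjoint_comp_self _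
  have hnorm : ∀ x, ‖(N ∘L V) x‖ = ‖opSqrt (adjoint V ∘L S ∘L V) x‖ := by
    intro x
    refine (pow_left_inj₀ (norm_nonneg _) (norm_nonneg _) two_ne_zero).1 ?_
    rw [norm_opSqrt_sq hpos, hQ, ContinuousLinearMap.comp_apply (adjoint _),
      ContinuousLinearMap.adjoint_inner_right, real_inner_self_eq_norm_sq]
  obtain ⟨U, h1, h2, -, h3, -⟩ := exists_partialIsometry _ _ hnorm
  refine ⟨hpos, fun x => (hnorm x).symm, U, h3, ?_⟩
  rw [ContinuousLinearMap.adjoint_comp, hNa, ContinuousLinearMap.comp_assoc, ← h1, h2]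

/-- The polar decomposition writes the root as `(S^{1/2} U)* V`, a product of two Hilbert-Schmidt
operators. -/
theorem isTraceClass_opSqrt {S : E →L[ℝ] E} (hS : S.IsPositive)
    (hN : HilbertSchmidt (opSqrt S)) {V : H →L[ℝ] E} (hV : HilbertSchmidt V) :
    IsTraceClass (opSqrt (adjoint V ∘L S ∘L V)) := by
  obtain ⟨hpos, -, U, -, hU⟩ := exists_polar hS V
  intro s b
  rw [adjoint_opSqrt hpos, opSqrt_comp_self hpos, hU]
  refine (hasSum_hsInner b (hN.comp_right U) hV).summable.congr fun i => ?_
  rw [ContinuousLinearMap.comp_apply (adjoint _), ContinuousLinearMap.adjoint_inner_right]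

variable [SecondCountableTopology E] [MeasurableSpace E] [BorelSpace E]

theorem lintegral_enorm_sq_eq_tsum {α ι : Type*} [MeasurableSpace α] {μ : Measure α} {f : α → E}
    (hf : AEMeasurable f μ) (b : HilbertBasis ι ℝ E) :
    ∫⁻ x, ‖f x‖ₑ ^ 2 ∂μ = ∑' i, ∫⁻ x, ENNReal.ofReal (⟪b i, f x⟫_ℝ ^ 2) ∂μ := by
  have := countable_hilbertBasis b
  rw [← lintegral_tsum fun i => by fun_prop]
  refine lintegral_congr fun x => ?_
  have h := hasSum_sq_inner b (f x)
  rw [← ENNReal.ofReal_tsum_of_nonneg (fun i => sq_nonneg _) h.summable, h.tsum_eq,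
    ← ofReal_norm, ENNReal.ofReal_pow (norm_nonneg _)]

/-- The operator `a ↦ ⟪a, X⟫` into `L²` of a square integrable random vector. -/
theorem exists_l2_operator {α : Type*} [MeasurableSpace α] {μ : Measure α} [IsFiniteMeasure μ]
    {X : α → E} (hX : MemLp X 2 μ) :
    ∃ Z : E →L[ℝ] Lp ℝ 2 μ, ∀ a, Z a =ᵐ[μ] fun x => ⟪a, X x⟫_ℝ := by
  let Y : Lp E 2 μ := hX.toLp
  have hY : Y =ᵐ[μ] X := hX.coeFn_toLp
  let Z₀ : E →ₗ[ℝ] Lp ℝ 2 μ :=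
    { toFun := fun a => (innerSL ℝ a).compLpL 2 μ Y
      map_add' := fun a b => by rw [map_add, ContinuousLinearMap.add_compLpL]; rfl
      map_smul' := fun c a => by
        rw [map_smul, RingHom.id_apply, ContinuousLinearMap.smul_compLpL]; rfl }
  refine ⟨Z₀.mkContinuous ‖Y‖ fun a => ?_, fun a => ?_⟩
  · refine (((innerSL ℝ a).compLpL 2 μ).le_opNorm Y).trans ?_
    rw [mul_comm]
    refine mul_le_mul_of_nonneg_left ?_ (norm_nonneg _)
    exact (ContinuousLinearMap.norm_compLpL_le _).trans (innerSL_apply_norm ℝ a).le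
  · refine ((innerSL ℝ a).coeFn_compLpL Y).trans ?_
    filter_upwards [hY] with x hx
    rw [hx, innerSL_apply_apply]

/-- The second moment of `⟪a, X⟫` is the covariance form. This is all that the lower bound uses
about each marginal. -/
theorem exists_l2_operator_marginal {α : Type*} [MeasurableSpace α] {μ : Measure α}
    [IsFiniteMeasure μ] {X : α → E} (hXm : AEMeasurable X μ) {π : Measure E} {S : E →L[ℝ] E}
    (hπ : IsCenteredGaussian π S) (hX : μ.map X = π) :
    ∃ Z : E →L[ℝ] Lp ℝ 2 μ, (∀ a, Z a =ᵐ[μ] fun x => ⟪a, X x⟫_ℝ) ∧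
      ∀ a, ‖Z a‖ ^ 2 = ⟪S a, a⟫_ℝ := by
  have := hπ.isGaussian
  have hL2 : MemLp id 2 π := IsGaussian.memLp_two_id
  have hX2 : MemLp X 2 μ := by
    rw [← hX, memLp_map_measure_iff (by fun_prop) hXm] at hL2
    exact hL2
  obtain ⟨Z, hZ⟩ := exists_l2_operator hX2
  refine ⟨Z, hZ, fun a => ?_⟩
  rw [← real_inner_self_eq_norm_sq, L2.inner_def, ← hπ.covariance, covarianceOperator_inner hL2,
    ← hX, integral_map hXm (Continuous.aestronglyMeasurable (by fun_prop))]
  refine integral_congr_ae ?_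
  filter_upwards [hZ a] with x hx
  rw [hx]
  rfl

/-- Lower bound for the transport cost between centered Gaussian measures. -/
theorem le_cost_of_coupling {S : E →L[ℝ] E} (hS : S.IsPositive)
    (hN : HilbertSchmidt (opSqrt S)) {V : H →L[ℝ] E} (hV : HilbertSchmidt V) {π₁ π₂ : Measure E}
    (h₁ : IsCenteredGaussian π₁ S) (h₂ : IsCenteredGaussian π₂ (V ∘L adjoint V))
    {γ : Measure (E × E)} (hγ₁ : γ.map Prod.fst = π₁) (hγ₂ : γ.map Prod.snd = π₂) :
    ENNReal.ofReal (hsInner (opSqrt S) (opSqrt S) + hsInner V V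
      - 2 * trace (opSqrt (adjoint V ∘L S ∘L V))) ≤ ∫⁻ z, ‖z.1 - z.2‖ₑ ^ 2 ∂γ := by
  obtain ⟨hpos, hKnorm, U, -, hU⟩ := exists_polar hS V
  set N := opSqrt S with hNdef
  set Q := adjoint V ∘L S ∘L V with hQdef
  have hprob : IsProbabilityMeasure γ := by
    have := h₁.isGaussian
    have h : IsProbabilityMeasure (γ.map Prod.fst) := by rw [hγ₁]; infer_instance
    exact (Measure.isProbabilityMeasure_map_iff measurable_fst.aemeasurable).1 h
  obtain ⟨Z, hZ, hZn⟩ := exists_l2_operator_marginal measurable_fst.aemeasurable h₁ hγ₁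
  obtain ⟨W, hW, hWn⟩ := exists_l2_operator_marginal measurable_snd.aemeasurable h₂ hγ₂
  have hZN : ∀ a, ‖Z a‖ = ‖N a‖ := fun a => by
    refine (pow_left_inj₀ (norm_nonneg _) (norm_nonneg _) two_ne_zero).1 ?_
    rw [hZn, norm_opSqrt_sq hS, real_inner_comm]
  have hWV : ∀ a, ‖W a‖ = ‖adjoint V a‖ := fun a => by
    refine (pow_left_inj₀ (norm_nonneg _) (norm_nonneg _) two_ne_zero).1 ?_
    rw [hWn, ContinuousLinearMap.comp_apply, ← ContinuousLinearMap.adjoint_inner_right,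
      real_inner_self_eq_norm_sq]
  have hZHS : HilbertSchmidt Z := hN.of_norm_le 1 fun x => by rw [hZN, one_mul]
  have hWHS : HilbertSchmidt W := hV.adjoint.of_norm_le 1 fun x => by rw [hWV, one_mul]
  -- `W = ζ V*` with a contraction `ζ`, so the cross term is `∑ ⟪Z (V e), ζ e⟫ ≤ ∑ ‖Z (V e)‖`. On an
  -- eigenbasis of `Q^{1/2}`, `‖Z (V e)‖ = ‖Q^{1/2} e‖` is the eigenvalue.
  obtain ⟨ζ, hζ, -, -, -, hζ1⟩ := exists_partialIsometry W (adjoint V) hWV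
  have hZW : hsInner Z W ≤ trace (opSqrt Q) := by
    have hQHS : HilbertSchmidt (opSqrt Q) := by
      rw [hU]
      exact hV.comp_left _
    obtain ⟨ι, e, t, ht⟩ := exists_eigenbasis (opSqrt_isPositive hpos).isSelfAdjoint
      hQHS.isCompactOperator
    have ht0 : ∀ i, t i = ‖Z (V (e i))‖ := by
      intro i
      have h0 : 0 ≤ t i := by
        have := (opSqrt_isPositive hpos).inner_nonneg_left (e i)
        rw [ht, real_inner_smul_left, real_inner_self_eq_norm_sq, e.orthonormal.1 i] at this
        simpa using this
      rw [hZN, ← hKnorm, ht, norm_smul, e.orthonormal.1 i, mul_one, Real.norm_of_nonneg h0]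
    have h1 : hsInner Z W = hsInner V (adjoint Z ∘L ζ) := by
      rw [← hζ, hsInner_comp_left, ← hsInner_adjoint (hZHS.comp_left _) hV.adjoint,
        ContinuousLinearMap.adjoint_adjoint, ContinuousLinearMap.adjoint_comp,
        ContinuousLinearMap.adjoint_adjoint]
    rw [h1, hU, trace_adjoint_comp]
    refine hasSum_le (fun i => ?_) (hasSum_hsInner e hV (hZHS.adjoint.comp_right ζ))
      (hasSum_hsInner e (hN.comp_right U) hV)
    have h2 : ⟪(N ∘L U) (e i), V (e i)⟫_ℝ = ‖Z (V (e i))‖ := by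
      rw [← ContinuousLinearMap.adjoint_inner_right (N ∘L U), ← ContinuousLinearMap.comp_apply,
        ← hU, ht, real_inner_smul_right, real_inner_self_eq_norm_sq, e.orthonormal.1 i, one_pow,
        mul_one, ht0]
    rw [h2, ContinuousLinearMap.comp_apply, ContinuousLinearMap.adjoint_inner_right]
    refine (real_inner_le_norm _ _).trans (mul_le_of_le_one_right (norm_nonneg _) ?_)
    exact (hζ1 _).trans (e.orthonormal.1 i).le
  -- Parseval under the integral: `Z - W` sends a basis vector to the corresponding coordinate of
  -- the displacement.
  have hcost : ∫⁻ z, ‖z.1 - z.2‖ₑ ^ 2 ∂γ = ENNReal.ofReal (hsInner (Z - W) (Z - W)) := by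
    have hHS : HilbertSchmidt (Z - W) := by
      rw [sub_eq_add_neg]
      exact hZHS.add hWHS.neg
    rw [lintegral_enorm_sq_eq_tsum (by fun_prop) (someBasis E), hsInner,
      ENNReal.ofReal_tsum_of_nonneg (fun _ => real_inner_self_nonneg)
        (hasSum_hsInner _ hHS hHS).summable]
    refine tsum_congr fun i => ?_
    have h1 : (Z - W) (someBasis E i) =ᵐ[γ] fun z => ⟪someBasis E i, z.1 - z.2⟫_ℝ := by
      rw [_root_.sub_apply]
      refine (Lp.coeFn_sub _ _).trans ?_
      filter_upwards [hZ (someBasis E i), hW (someBasis E i)] with z h2 h3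
      rw [Pi.sub_apply, h2, h3, inner_sub_right]
    have h2 : ⟪(Z - W) (someBasis E i), (Z - W) (someBasis E i)⟫_ℝ
        = ∫ z, ⟪someBasis E i, z.1 - z.2⟫_ℝ ^ 2 ∂γ := by
      rw [L2.inner_def]
      refine integral_congr_ae ?_
      filter_upwards [h1] with z hz
      rw [hz, real_inner_self_eq_norm_sq, Real.norm_eq_abs, sq_abs]
    have h3 : Integrable (fun z : E × E => ⟪someBasis E i, z.1 - z.2⟫_ℝ ^ 2) γ := by
      refine (L2.integrable_inner ((Z - W) (someBasis E i)) ((Z - W) (someBasis E i))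
        (𝕜 := ℝ)).congr ?_
      filter_upwards [h1] with z hz
      rw [hz, real_inner_self_eq_norm_sq, Real.norm_eq_abs, sq_abs]
    rw [h2, ofReal_integral_eq_lintegral_ofReal h3 (Filter.Eventually.of_forall fun z =>
      sq_nonneg _)]
  rw [hcost]
  refine ENNReal.ofReal_le_ofReal ?_
  rw [hsInner_sub_self hZHS hWHS, hsInner_self_congr hZN, hsInner_self_congr hWV,
    hsInner_adjoint hV hV]
  linarith

/-- Centered Gaussian measures with covariances `S` and `V V*`, coupled optimally. -/
theorem exists_optimal_coupling {S : E →L[ℝ] E} (hS : S.IsPositive)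
    (hN : HilbertSchmidt (opSqrt S)) {V : H →L[ℝ] E} (hV : HilbertSchmidt V) :
    ∃ γ : Measure (E × E), IsCenteredGaussian (γ.map Prod.fst) S ∧
      IsCenteredGaussian (γ.map Prod.snd) (V ∘L adjoint V) ∧
      0 ≤ hsInner (opSqrt S) (opSqrt S) + hsInner V V
        - 2 * trace (opSqrt (adjoint V ∘L S ∘L V)) ∧
      ∫⁻ z, ‖z.1 - z.2‖ₑ ^ 2 ∂γ = ENNReal.ofReal (hsInner (opSqrt S) (opSqrt S) + hsInner V V
        - 2 * trace (opSqrt (adjoint V ∘L S ∘L V))) := by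
  obtain ⟨hpos, -, U, hUUU, hU⟩ := exists_polar hS V
  set N := opSqrt S with hNdef
  set Q := adjoint V ∘L S ∘L V with hQdef
  have hNa : adjoint N = N := adjoint_opSqrt hS
  -- `D` is the projection complementary to `U* U`. It supplies the part of `V V*` that `V U*`
  -- misses.
  set D : H →L[ℝ] H := 1 - adjoint U ∘L U with hD
  have hDa : adjoint D = D := by
    rw [hD, map_sub, ContinuousLinearMap.adjoint_comp, ContinuousLinearMap.adjoint_adjoint]
    congr 1
    exact (IsSelfAdjoint.one (H →L[ℝ] H)).adjoint_eq
  have hDD : ∀ x, D (D x) = D x := by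
    intro x
    have h1 : adjoint U (U (adjoint U (U x))) = adjoint U (U x) :=
      congrArg (fun T => T (U x)) hUUU
    simp [hD, h1]
  obtain ⟨s, κ, -⟩ := exists_hilbertBasis ℝ E
  obtain ⟨r, η, -⟩ := exists_hilbertBasis ℝ H
  have hVU : HilbertSchmidt (V ∘L adjoint U) := hV.comp_right _
  have hVD : HilbertSchmidt (V ∘L D) := hV.comp_right _
  have hmem : ∀ {f : s ⊕ r → E}, Summable (fun i => ‖f i‖ ^ 2) → Memℓp f 2 := by
    intro f hf
    rw [memℓp_gen_iff (by norm_num)]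
    simpa using hf
  -- With independent white noises `ξ` on `E` and `ξ'` on `H`, the coupled vectors are formally `N
  -- ξ` and `V U* ξ + V D ξ'`. Only the shared `ξ` correlates them, contributing `tr ((N U)* V) = tr
  -- Q^{1/2}`.
  obtain ⟨v, hvl, hvr⟩ : ∃ v : lp (fun _ : s ⊕ r => E) 2, (∀ k, v (Sum.inl k) = N (κ k)) ∧
      ∀ i, v (Sum.inr i) = 0 :=
    ⟨⟨Sum.elim (fun k => N (κ k)) (fun _ => 0), hmem <| Summable.sum _ (hN.summable κ) <| by
      simp [Function.comp_def]⟩, fun _ => rfl, fun _ => rfl⟩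
  obtain ⟨w, hwl, hwr⟩ : ∃ w : lp (fun _ : s ⊕ r => E) 2,
      (∀ k, w (Sum.inl k) = (V ∘L adjoint U) (κ k)) ∧ ∀ i, w (Sum.inr i) = (V ∘L D) (η i) :=
    ⟨⟨Sum.elim (fun k => V (adjoint U (κ k))) (fun i => V (D (η i))),
      hmem <| Summable.sum _ (hVU.summable κ) (hVD.summable η)⟩, fun _ => rfl, fun _ => rfl⟩
  have hvm : AEMeasurable (noiseSeries v) (noiseMeasure (s ⊕ r)) :=
    (Lp.aestronglyMeasurable _).aemeasurable
  have hwm : AEMeasurable (noiseSeries w) (noiseMeasure (s ⊕ r)) :=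
    (Lp.aestronglyMeasurable _).aemeasurable
  have hvv : ⟪v, v⟫_ℝ = hsInner N N := by
    refine (lp.hasSum_inner (𝕜 := ℝ) v v).unique ?_
    rw [← add_zero (hsInner N N)]
    refine HasSum.sum ?_ ?_
    · simpa only [Function.comp_def, hvl] using hasSum_hsInner κ hN hN
    · simpa only [Function.comp_def, hvr, inner_zero_left] using hasSum_zero
  have hww : ⟪w, w⟫_ℝ = hsInner V V := by
    refine (lp.hasSum_inner (𝕜 := ℝ) w w).unique ?_
    have h1 : hsInner V V
        = hsInner (V ∘L adjoint U) (V ∘L adjoint U) + hsInner (V ∘L D) (V ∘L D) := by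
      rw [hsInner_comp_right hVU hV, hsInner_comp_right hVD hV,
        hsInner_comm ((V ∘L adjoint U) ∘L adjoint (adjoint U)) V,
        hsInner_comm ((V ∘L D) ∘L adjoint D) V,
        ← hsInner_add_right hV (hVU.comp_right _) (hVD.comp_right _)]
      congr 1
      ext x
      have := hDD x
      simp only [_root_.add_apply, ContinuousLinearMap.comp_apply, hDa,
        ContinuousLinearMap.adjoint_adjoint, this, ← map_add]
      simp [hD]
    rw [h1]
    refine HasSum.sum ?_ ?_
    · simpa only [Function.comp_def, hwl] using hasSum_hsInner κ hVU hVU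
    · simpa only [Function.comp_def, hwr] using hasSum_hsInner η hVD hVD
  have hvw : ⟪v, w⟫_ℝ = trace (opSqrt Q) := by
    refine (lp.hasSum_inner (𝕜 := ℝ) v w).unique ?_
    have h1 : trace (opSqrt Q) = hsInner N (V ∘L adjoint U) + 0 := by
      rw [hU, trace_adjoint_comp, hsInner_comp_right hN hV, ContinuousLinearMap.adjoint_adjoint,
        add_zero]
    rw [h1]
    refine HasSum.sum ?_ ?_
    · simpa only [Function.comp_def, hvl, hwl] using hasSum_hsInner κ hN hVU
    · simpa only [Function.comp_def, hvr, inner_zero_left] using hasSum_zero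
  have hsub : hsInner N N + hsInner V V - 2 * trace (opSqrt Q)
      = ‖noiseSeries v - noiseSeries w‖ ^ 2 := by
    rw [← real_inner_self_eq_norm_sq, real_inner_sub_sub_self, inner_noiseSeries,
      inner_noiseSeries, inner_noiseSeries, hvv, hww, hvw]
    ring
  refine ⟨(noiseMeasure (s ⊕ r)).map fun ω => (noiseSeries v ω, noiseSeries w ω), ?_, ?_, ?_, ?_⟩
  · rw [AEMeasurable.map_map_of_aemeasurable measurable_fst.aemeasurable (hvm.prodMk hwm)]
    refine isCenteredGaussian_noiseSeries v fun a b => ?_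
    refine (HasSum.tsum_eq ?_).symm
    rw [← add_zero ⟪S a, b⟫_ℝ]
    refine HasSum.sum ?_ ?_
    · have h1 := κ.hasSum_inner_mul_inner (N a) (N b)
      rw [← ContinuousLinearMap.adjoint_inner_left, hNa, opSqrt_apply_apply hS] at h1
      refine h1.congr_fun fun k => ?_
      simp only [Function.comp, hvl]
      rw [← ContinuousLinearMap.adjoint_inner_left, ← ContinuousLinearMap.adjoint_inner_left, hNa,
        real_inner_comm (N b)]
    · simpa only [Function.comp_def, hvr, inner_zero_right, mul_zero] using hasSum_zero
  · rw [AEMeasurable.map_map_of_aemeasurable measurable_snd.aemeasurable (hvm.prodMk hwm)]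
    refine isCenteredGaussian_noiseSeries w fun a b => ?_
    refine (HasSum.tsum_eq ?_).symm
    have h0 : ⟪(V ∘L adjoint V) a, b⟫_ℝ = ⟪U (adjoint V a), U (adjoint V b)⟫_ℝ
        + ⟪D (adjoint V a), D (adjoint V b)⟫_ℝ := by
      rw [← ContinuousLinearMap.adjoint_inner_left D, hDa, hDD,
        ← ContinuousLinearMap.adjoint_inner_left U, ← inner_add_left,
        ContinuousLinearMap.comp_apply, ← ContinuousLinearMap.adjoint_inner_right]
      congr 1
      simp [hD]
    rw [h0]
    refine HasSum.sum ?_ ?_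
    · refine (κ.hasSum_inner_mul_inner _ _).congr_fun fun k => ?_
      simp only [Function.comp, hwl, ContinuousLinearMap.comp_apply]
      rw [← ContinuousLinearMap.adjoint_inner_left V, ← ContinuousLinearMap.adjoint_inner_left V,
        ContinuousLinearMap.adjoint_inner_right, ContinuousLinearMap.adjoint_inner_right,
        real_inner_comm (U (adjoint V b))]
    · refine (η.hasSum_inner_mul_inner _ _).congr_fun fun i => ?_
      simp only [Function.comp, hwr, ContinuousLinearMap.comp_apply]
      rw [← ContinuousLinearMap.adjoint_inner_left V, ← ContinuousLinearMap.adjoint_inner_left V,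
        ← ContinuousLinearMap.adjoint_inner_left D, ← ContinuousLinearMap.adjoint_inner_left D,
        hDa, real_inner_comm (D (adjoint V b))]
  · rw [hsub]
    positivity
  · rw [hsub, lintegral_map' (by fun_prop) (hvm.prodMk hwm), Lp.norm_def]
    have h1 : eLpNorm (noiseSeries v - noiseSeries w : Lp E 2 (noiseMeasure (s ⊕ r))) 2
        (noiseMeasure (s ⊕ r)) ≠ ∞ := Lp.eLpNorm_ne_top _
    rw [← ENNReal.toReal_pow, ENNReal.ofReal_toReal (ENNReal.pow_ne_top h1),
      eLpNorm_eq_lintegral_rpow_enorm_toReal two_ne_zero ENNReal.ofNat_ne_top,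
      ← ENNReal.rpow_natCast, ← ENNReal.rpow_mul]
    simp only [ENNReal.toReal_ofNat, Nat.cast_ofNat, ENNReal.rpow_ofNat]
    have h2 : (2⁻¹ * 2 : ℝ) = 1 := by norm_num
    rw [one_div, h2, ENNReal.rpow_one]
    refine lintegral_congr_ae ?_
    filter_upwards [Lp.coeFn_sub (noiseSeries v) (noiseSeries w)] with ω hω
    rw [hω, Pi.sub_apply]

theorem exists_gaussian_wasserstein {S : E →L[ℝ] E} (hS : S.IsPositive)
    (hN : HilbertSchmidt (opSqrt S)) {V : H →L[ℝ] E} (hV : HilbertSchmidt V) :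
    ∃ π₁ π₂ : Measure E, IsCenteredGaussian π₁ S ∧ IsCenteredGaussian π₂ (V ∘L adjoint V) ∧
      wasserstein2 π₁ π₂ ≠ ∞ ∧ (wasserstein2 π₁ π₂).toReal ^ 2
        = hsInner (opSqrt S) (opSqrt S) + hsInner V V
          - 2 * trace (opSqrt (adjoint V ∘L S ∘L V)) := by
  obtain ⟨γ, h₁, h₂, h0, hγ⟩ := exists_optimal_coupling hS hN hV
  set c := hsInner (opSqrt S) (opSqrt S) + hsInner V V
    - 2 * trace (opSqrt (adjoint V ∘L S ∘L V)) with hc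
  have hw : wasserstein2 (γ.map Prod.fst) (γ.map Prod.snd) = ENNReal.ofReal c ^ (1 / 2 : ℝ) := by
    rw [wasserstein2]
    congr 1
    refine le_antisymm ?_ ?_
    · exact (iInf₂_le γ ⟨rfl, rfl⟩).trans hγ.le
    · exact le_iInf₂ fun γ' hγ' => le_cost_of_coupling hS hN hV h₁ h₂ hγ'.1 hγ'.2
  refine ⟨_, _, h₁, h₂, ?_, ?_⟩
  · rw [hw]
    exact ENNReal.rpow_ne_top_of_nonneg (by norm_num) ENNReal.ofReal_ne_top
  · rw [hw, ← ENNReal.toReal_rpow, ENNReal.toReal_ofReal h0, ← Real.sqrt_eq_rpow, Real.sq_sqrt h0]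

end Wasserstein

/-! ### The joint covariance operators -/

section JointCovariance

variable {H : Type*} [NormedAddCommGroup H] [InnerProductSpace ℝ H] [CompleteSpace H]

/-- The operator `x ↦ (G x, M x)`. -/
def jointFactor (G M : H →L[ℝ] H) : H →L[ℝ] WithLp 2 (H × H) :=
  (WithLp.prodContinuousLinearEquiv 2 ℝ H H).symm.toContinuousLinearMap ∘L G.prod M

theorem jointFactor_fst (G M : H →L[ℝ] H) (x : H) : (jointFactor G M x).fst = G x := rfl

theorem jointFactor_snd (G M : H →L[ℝ] H) (x : H) : (jointFactor G M x).snd = M x := rfl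

theorem jointCov_fst (A B C : H →L[ℝ] H) (z : WithLp 2 (H × H)) :
    (jointCov A B C z).fst = A z.fst + C z.snd := rfl

theorem jointCov_snd (A B C : H →L[ℝ] H) (z : WithLp 2 (H × H)) :
    (jointCov A B C z).snd = adjoint C z.fst + B z.snd := rfl

theorem adjoint_jointFactor_apply (G M : H →L[ℝ] H) (z : WithLp 2 (H × H)) :
    adjoint (jointFactor G M) z = adjoint G z.fst + adjoint M z.snd := by
  refine ext_inner_right ℝ fun x => ?_
  rw [ContinuousLinearMap.adjoint_inner_left, WithLp.prod_inner_apply, inner_add_left,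
    ContinuousLinearMap.adjoint_inner_left, ContinuousLinearMap.adjoint_inner_left]
  rfl

theorem jointFactor_comp_adjoint (G M : H →L[ℝ] H) :
    jointFactor G M ∘L adjoint (jointFactor G M)
      = jointCov (G ∘L adjoint G) (M ∘L adjoint M) (G ∘L adjoint M) := by
  ext z
  rw [ContinuousLinearMap.comp_apply, adjoint_jointFactor_apply]
  refine WithLp.ofLp_injective 2 (Prod.ext ?_ ?_)
  · change G _ = G (adjoint G z.fst) + G (adjoint M z.snd)
    rw [map_add]
  · change M _ = adjoint (G ∘L adjoint M) z.fst + M (adjoint M z.snd)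
    rw [map_add, ContinuousLinearMap.adjoint_comp, ContinuousLinearMap.adjoint_adjoint]
    rfl

theorem hilbertSchmidt_jointFactor {G M : H →L[ℝ] H} (hG : HilbertSchmidt G)
    (hM : HilbertSchmidt M) : HilbertSchmidt (jointFactor G M) := by
  refine (Summable.add hG hM).congr fun i => ?_
  rw [WithLp.prod_norm_sq_eq_of_L2]
  rfl

theorem hsInner_jointFactor {G M : H →L[ℝ] H} (hG : HilbertSchmidt G) (hM : HilbertSchmidt M) :
    hsInner (jointFactor G M) (jointFactor G M) = hsInner G G + hsInner M M := by
  rw [hsInner, hsInner, hsInner, ← Summable.tsum_add (hasSum_hsInner _ hG hG).summable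
    (hasSum_hsInner _ hM hM).summable]
  rfl

theorem adjoint_jointFactor_comp_jointCov (G M R : H →L[ℝ] H) (hR : IsSelfAdjoint R) :
    adjoint (jointFactor G M) ∘L jointCov (G ∘L adjoint G) (M ∘L adjoint M)
      (G ∘L R ∘L adjoint M) ∘L jointFactor G M = distOp G M R := by
  ext x
  rw [ContinuousLinearMap.comp_apply, ContinuousLinearMap.comp_apply, adjoint_jointFactor_apply,
    jointCov_fst, jointCov_snd, jointFactor_fst, jointFactor_snd]
  simp only [distOp, ContinuousLinearMap.adjoint_comp, ContinuousLinearMap.adjoint_adjoint,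
    hR.adjoint_eq, sq, _root_.add_apply, mul_apply_eq_comp, ContinuousLinearMap.comp_apply,
    map_add]
  abel

theorem inner_jointCov_self (G M R : H →L[ℝ] H) (z : WithLp 2 (H × H)) :
    ⟪jointCov (G ∘L adjoint G) (M ∘L adjoint M) (G ∘L R ∘L adjoint M) z, z⟫_ℝ
      = ‖adjoint G z.fst‖ ^ 2 + ‖adjoint M z.snd‖ ^ 2
        + 2 * ⟪adjoint G z.fst, R (adjoint M z.snd)⟫_ℝ := by
  rw [WithLp.prod_inner_apply]
  change ⟪G (adjoint G z.fst) + G (R (adjoint M z.snd)), z.fst⟫_ℝ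
    + ⟪adjoint (G ∘L R ∘L adjoint M) z.fst + M (adjoint M z.snd), z.snd⟫_ℝ = _
  have h1 : ∀ (T : H →L[ℝ] H) x, ⟪T (adjoint T x), x⟫_ℝ = ‖adjoint T x‖ ^ 2 := fun T x => by
    rw [← ContinuousLinearMap.adjoint_inner_right, real_inner_self_eq_norm_sq]
  have h2 : ⟪G (R (adjoint M z.snd)), z.fst⟫_ℝ = ⟪adjoint G z.fst, R (adjoint M z.snd)⟫_ℝ := by
    rw [ContinuousLinearMap.adjoint_inner_left, real_inner_comm]
  have h3 : ⟪adjoint (G ∘L R ∘L adjoint M) z.fst, z.snd⟫_ℝ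
      = ⟪adjoint G z.fst, R (adjoint M z.snd)⟫_ℝ := by
    rw [ContinuousLinearMap.adjoint_inner_left, ContinuousLinearMap.adjoint_inner_left]
    rfl
  rw [inner_add_left, inner_add_left, h1, h1, h2, h3]
  ring

/-- Since `R` is a contraction, the quadratic form is at least `(‖G* x‖ - ‖M* y‖)²`. -/
theorem jointCov_isPositive (G M R : H →L[ℝ] H) (hR : ∀ x, ‖R x‖ ≤ ‖x‖) :
    (jointCov (G ∘L adjoint G) (M ∘L adjoint M) (G ∘L R ∘L adjoint M)).IsPositive := by
  rw [ContinuousLinearMap.isPositive_iff']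
  refine ⟨?_, fun z => ?_⟩
  · rw [ContinuousLinearMap.isSelfAdjoint_iff_isSymmetric]
    intro z w
    change ⟪jointCov _ _ _ z, w⟫_ℝ = ⟪z, jointCov _ _ _ w⟫_ℝ
    rw [WithLp.prod_inner_apply, WithLp.prod_inner_apply]
    change ⟪G (adjoint G z.fst) + (G ∘L R ∘L adjoint M) z.snd, w.fst⟫_ℝ
        + ⟪adjoint (G ∘L R ∘L adjoint M) z.fst + M (adjoint M z.snd), w.snd⟫_ℝ
      = ⟪z.fst, G (adjoint G w.fst) + (G ∘L R ∘L adjoint M) w.snd⟫_ℝ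
        + ⟪z.snd, adjoint (G ∘L R ∘L adjoint M) w.fst + M (adjoint M w.snd)⟫_ℝ
    simp only [inner_add_left, inner_add_right, ContinuousLinearMap.adjoint_inner_left (_ ∘L _),
      ContinuousLinearMap.adjoint_inner_right (_ ∘L _)]
    rw [← ContinuousLinearMap.adjoint_inner_right G, ← ContinuousLinearMap.adjoint_inner_right M,
      ← ContinuousLinearMap.adjoint_inner_left G, ← ContinuousLinearMap.adjoint_inner_left M]
    ring
  · rw [inner_jointCov_self]
    have h1 := (abs_le.1 (abs_real_inner_le_norm (adjoint G z.fst) (R (adjoint M z.snd)))).1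
    have h2 := mul_le_mul_of_nonneg_left (hR (adjoint M z.snd)) (norm_nonneg (adjoint G z.fst))
    nlinarith [sq_nonneg (‖adjoint G z.fst‖ - ‖adjoint M z.snd‖)]

/-- The trace of the block operator is that of its diagonal. With `g x = (G x, 0)` and `m x = (0, M
x)`, the off-diagonal contribution pairs `g` with `m R*`, whose ranges are orthogonal. -/
theorem hsInner_opSqrt_jointCov {G M R : H →L[ℝ] H} (hG : HilbertSchmidt G)
    (hM : HilbertSchmidt M) (hR : ∀ x, ‖R x‖ ≤ ‖x‖) :
    HilbertSchmidt (opSqrt (jointCov (G ∘L adjoint G) (M ∘L adjoint M) (G ∘L R ∘L adjoint M))) ∧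
    hsInner (opSqrt (jointCov (G ∘L adjoint G) (M ∘L adjoint M) (G ∘L R ∘L adjoint M)))
      (opSqrt (jointCov (G ∘L adjoint G) (M ∘L adjoint M) (G ∘L R ∘L adjoint M)))
      = hsInner G G + hsInner M M := by
  have hpos := jointCov_isPositive G M R hR
  set S := jointCov (G ∘L adjoint G) (M ∘L adjoint M) (G ∘L R ∘L adjoint M) with hS
  have h0 : HilbertSchmidt (0 : H →L[ℝ] H) := hG.of_norm_le 0 fun x => by simp
  have hg := hilbertSchmidt_jointFactor hG h0
  have hm := hilbertSchmidt_jointFactor h0 hM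
  set g := jointFactor G 0 with hgdef
  set m := jointFactor 0 M with hmdef
  have hgg : hsInner (adjoint g) (adjoint g) = hsInner G G := by
    rw [hsInner_adjoint hg hg, hsInner_jointFactor hG h0]
    simp [hsInner]
  have hmm : hsInner (adjoint m) (adjoint m) = hsInner M M := by
    rw [hsInner_adjoint hm hm, hsInner_jointFactor h0 hM]
    simp [hsInner]
  have hgm : hsInner (adjoint g) (R ∘L adjoint m) = 0 := by
    have h1 : R ∘L adjoint m = adjoint (m ∘L adjoint R) := by
      rw [ContinuousLinearMap.adjoint_comp, ContinuousLinearMap.adjoint_adjoint]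
    rw [h1, hsInner_adjoint (hm.comp_right _) hg, hsInner]
    refine (tsum_congr fun i => ?_).trans tsum_zero
    rw [WithLp.prod_inner_apply]
    change ⟪(0 : H), _⟫_ℝ + ⟪_, (0 : H)⟫_ℝ = 0
    rw [inner_zero_left, inner_zero_right, add_zero]
  have hga : ∀ z, adjoint g z = adjoint G z.fst := fun z => by
    rw [adjoint_jointFactor_apply, map_zero, _root_.zero_apply, add_zero]
  have hma : ∀ z, adjoint m z = adjoint M z.snd := fun z => by
    rw [adjoint_jointFactor_apply, map_zero, _root_.zero_apply, zero_add]
  have hsum := (((hasSum_hsInner (someBasis (WithLp 2 (H × H))) hg.adjoint hg.adjoint).add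
    (hasSum_hsInner (someBasis _) hm.adjoint hm.adjoint)).add
    ((hasSum_hsInner (someBasis _) hg.adjoint (hm.adjoint.comp_left R)).mul_left 2)).congr_fun
      (g := fun i => ⟪someBasis _ i, S (someBasis _ i)⟫_ℝ) fun i => by
        rw [real_inner_comm, hS, inner_jointCov_self, real_inner_self_eq_norm_sq,
          real_inner_self_eq_norm_sq, ContinuousLinearMap.comp_apply, hga, hma]
  rw [hgg, hmm, hgm, mul_zero, add_zero] at hsum
  refine ⟨hilbertSchmidt_opSqrt hpos hsum.summable, ?_⟩
  rw [← trace_adjoint_comp, adjoint_opSqrt hpos, opSqrt_comp_self hpos]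
  exact hsum.tsum_eq

/-- `‖M* x‖ = ‖B^{1/2} x‖`, and the root of a covariance operator is Hilbert-Schmidt. -/
theorem HilbertSchmidt.of_comp_adjoint_eq {M B : H →L[ℝ] H} (hB : IsCovariance B)
    (hM : M ∘L ContinuousLinearMap.adjoint M = B) : HilbertSchmidt M := by
  rw [← ContinuousLinearMap.adjoint_adjoint M]
  refine (hB.hilbertSchmidt_opSqrt.of_norm_le 1 fun x => ?_).adjoint
  rw [one_mul]
  refine (pow_left_inj₀ (norm_nonneg _) (norm_nonneg _) two_ne_zero).1 ?_ |>.le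
  rw [norm_opSqrt_sq hB.1, ← hM, ContinuousLinearMap.comp_apply,
    ← ContinuousLinearMap.adjoint_inner_left, real_inner_self_eq_norm_sq]

theorem trace_add_sub_opSqrt {G M Q : H →L[ℝ] H} (hG : HilbertSchmidt G) (hM : HilbertSchmidt M)
    (hQ : Q.IsPositive) (hQ' : IsTraceClass (opSqrt Q)) :
    trace (G ∘L adjoint G + M ∘L adjoint M - opSqrt Q)
      = hsInner G G + hsInner M M - trace (opSqrt Q) := by
  have h1 : Summable fun i => ⟪someBasis H i, opSqrt Q (someBasis H i)⟫_ℝ := by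
    have := hQ' _ (someBasis H)
    rwa [adjoint_opSqrt hQ, opSqrt_comp_self hQ] at this
  rw [← hsInner_adjoint hG hG, ← hsInner_adjoint hM hM]
  refine ((((hasSum_hsInner (someBasis H) hG.adjoint hG.adjoint).add
    (hasSum_hsInner (someBasis H) hM.adjoint hM.adjoint)).sub h1.hasSum).congr_fun
      fun i => ?_).tsum_eq
  simp only [_root_.sub_apply, _root_.add_apply, inner_sub_right, inner_add_right,
    ContinuousLinearMap.comp_apply, ContinuousLinearMap.adjoint_inner_left]

end JointCovariance

end

end GaussianEOT

/-! ### The main theorem -/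

open GaussianEOT in
theorem mainTheorem5 {H : Type*} [NormedAddCommGroup H] [InnerProductSpace ℝ H] [CompleteSpace H]
    [SecondCountableTopology H] [MeasurableSpace H] [BorelSpace H]
    (A B : H →L[ℝ] H) (hA : IsCovariance A) (hB : IsCovariance B) (hAB : Reachable A B)
    (ε : ℝ) (hε : 0 < ε) :
    ∃ R : H →L[ℝ] H,
      IsEntropicArgmax ε (greenG A) (greenM A B) R ∧
      IsFunctionOf (shrinkage ε)
        (ContinuousLinearMap.adjoint (greenG A) ∘L greenM A B) R ∧
      ∃ π_ε π₀ : Measure (WithLp 2 (H × H)),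
        IsCenteredGaussian π_ε
          (jointCov A B (greenG A ∘L R ∘L ContinuousLinearMap.adjoint (greenM A B))) ∧
        IsCenteredGaussian π₀
          (jointCov A B (greenG A ∘L ContinuousLinearMap.adjoint (greenM A B))) ∧
        (distOp (greenG A) (greenM A B) R).IsPositive ∧
        IsTraceClass (opSqrt (distOp (greenG A) (greenM A B) R)) ∧
        wasserstein2 π_ε π₀ ≠ ∞ ∧
        (wasserstein2 π_ε π₀).toReal ^ 2
          = 2 * trace (A + B - opSqrt (distOp (greenG A) (greenM A B) R)) := by
  obtain ⟨hGM, hMM⟩ := greenM_spec hA.1 hB.1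
  have hG : HilbertSchmidt (greenG A) := hA.hilbertSchmidt_opSqrt
  have hM : HilbertSchmidt (greenM A B) := .of_comp_adjoint_eq hB hMM
  have hGG : greenG A ∘L ContinuousLinearMap.adjoint (greenG A) = A := by
    rw [greenG, adjoint_opSqrt hA.1, opSqrt_comp_self hA.1]
  have hP : (ContinuousLinearMap.adjoint (greenG A) ∘L greenM A B).IsPositive := by
    rw [hGM]
    exact opSqrt_isPositive (crossOp_isPositive hA.1 hB.1)
  obtain ⟨R, hmax, hfun, hRsa, hR⟩ := exists_entropicArgmax hG hM hP hε
  have hS := jointCov_isPositive (greenG A) (greenM A B) R hR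
  obtain ⟨hN, hNN⟩ := hsInner_opSqrt_jointCov hG hM hR
  have hV := hilbertSchmidt_jointFactor hG hM
  have hpos := (exists_polar hS (jointFactor (greenG A) (greenM A B))).1
  have htc := isTraceClass_opSqrt hS hN hV
  -- Here the first covariance is `Σ_ε`, the second is `V V* = Σ₀`, and `V* Σ_ε V = Q_ε`.
  obtain ⟨π_ε, π₀, h₁, h₂, hfin, hw⟩ := exists_gaussian_wasserstein hS hN hV
  rw [adjoint_jointFactor_comp_jointCov _ _ _ hRsa] at hpos htc hw
  have htr := trace_add_sub_opSqrt hG hM hpos htc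
  rw [hNN, hsInner_jointFactor hG hM] at hw
  rw [jointFactor_comp_adjoint] at h₂
  rw [hGG, hMM] at h₁ h₂ htr
  refine ⟨R, hmax, hfun, π_ε, π₀, h₁, h₂, hpos, htc, hfin, ?_⟩
  rw [hw, htr]
  ring
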